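/- Let $\mathbb H$ be the quaternions. For $s\in\{-1,1\}$ let $\mathbb A_s$ be $\mathbb H\oplus\mathbb H$ with the multiplication $$(q_1,q_2)(p_1,p_2)=(q_1p_1+s\,\bar p_2q_2,\;p_2q_1+q_2\bar p_1),$$ conjugation $\overline{(q_1,q_2)}=(\bar q_1,-q_2)$, inner product $\langle a,b\rangle=\mathrm{Re}(a\bar b)$ and $|a|^2=\langle a,a\rangle$. So $\mathbb O=\mathbb A_{-1}$ are the octonions and $\mathbb O'=\mathbb A_{1}$ the para-octonions (there $|\cdot|^2$ has signature $(4,4)$). **The planes.** For $i=1,2,3$ let $U_i\subset\mathbb A_s^3$ be the set of triples $(a_1,a_2,a_3)$ with $a_i=1$ and $|a_1|^2+|a_2|^2+|a_3|^2>0$. On $U_1\cup U_2\cup U_3$ write $a\sim b$ if there is $\lambda\in\mathbb A_s$ with $|\lambda|^2>0$ and $a_j=b_j\lambda$ for all $j$; this is an equivalence relation, and the quotient is $\mathbb OP^2$ for $s=-1$ (where the inequalities only say $\lambda\ne0$) and $\mathbb O'P^2$ for $s=1$. It is a smooth $16$-manifold with the three charts $[1,u,v]\mapsto(u,v)$, $[u,1,v]\mapsto(u,v)$,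 $[u,v,1]\mapsto(u,v)$, each with image $\{1+|u|^2+|v|^2>0\}\subset\mathbb A_s^2$. Its metric is given in each of the three charts by $$ds^2=\frac{|du|^2(1+|v|^2)+|dv|^2(1+|u|^2)-2\,\mathrm{Re}\big[(u\bar v)(dv\,d\bar u)\big]}{(1+|u|^2+|v|^2)^2}.$$ The octonionic hyperbolic plane is $\mathbb OH^2=\{(u,v)\in\mathbb O^2:|u|^2+|v|^2<1\}$ with the metric $$ds^2=\frac{|du|^2(1-|v|^2)+|dv|^2(1-|u|^2)+2\,\mathrm{Re}\big[(u\bar v)(dv\,d\bar u)\big]}{(1-|u|^2-|v|^2)^2}.$$ **Special Osserman manifolds.** Let $(M,g)$ be a semi-Riemannian manifold, with curvature $R(x,y)=\nabla_y\nabla_x-\nabla_x\nabla_y+\nabla_{[x,y]}$ of the Levi-Civita connection, Jacobi operators $\mathcal J_v(x)=R(v,x)v$ on $T_PM$, and $\varepsilon_v=g(v,v)$; a vector $v$ is unit if $\varepsilon_v=\pm1$. $(M,g)$ is a special Osserman manifold with constants $\lambda\neq\mu$, both non-zero, if for all $P\in M$: * (I) for every unit $v\in T_PM$, $\mathcal J_v$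 maps $v^\perp$ to itself, and $\mathcal J_v:v^\perp\to v^\perp$ is diagonalizable with exactly two non-zero eigenvalues, $\varepsilon_v\lambda$ and $\varepsilon_v\mu$; * (II) if $v,w\in T_PM$ are unit and $w\in E_\lambda(v):=\mathrm{span}\{v\}\oplus\ker(\mathcal J_v-\varepsilon_v\lambda\,\mathrm{Id})$, then $E_\lambda(v)=E_\lambda(w)$; * (III) if $v\in T_PM$ is unit, $w\in T_PM$ and $w\in\ker(\mathcal J_v-\varepsilon_v\mu\,\mathrm{Id})$, then $v\in\ker(\mathcal J_w-\varepsilon_w\mu\,\mathrm{Id})$. **Theorem.** The formulas for $ds^2$ above define semi-Riemannian metrics on $\mathbb OP^2$, $\mathbb O'P^2$ and $\mathbb OH^2$ (in particular, on the first two the expressions in the three charts agree on overlaps). With these metrics, $\mathbb OP^2$ and $\mathbb O'P^2$ are special Osserman manifolds with constants $\lambda=4$, $\mu=1$, and $\mathbb OH^2$ is a special Osserman manifold with constants $\lambda=-4$, $\mu=-1$. In all three cases, at every point and for every unit $v$, the eigenvalue $\varepsilon_v\lambda$ of $\mathcal J_v:v^\perp\to v^\perp$ has multiplicity $7$ and $\varepsilon_v\mu$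 has multiplicity $8$. -/

import Mathlib

open scoped Quaternion Manifold ContDiff

set_option maxSynthPendingDepth 3

noncomputable section

/-! ### Octonions and para-octonions -/

/-- The algebra `ℍ ⊕ ℍ` with multiplication
`(q₁, q₂) * (p₁, p₂) = (q₁ p₁ + s p̄₂ q₂, p₂ q₁ + q₂ p̄₁)`. The normed space structure is that of
`ℍ × ℍ`; it only serves to give the 8-dimensional real vector space its topology. -/
def CayleyAlgebra (_s : ℝ) : Type := ℍ[ℝ] × ℍ[ℝ]

/-- The octonions `𝕆`. -/
abbrev Octonion : Type := CayleyAlgebra (-1)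

/-- The para-octonions (split octonions) `𝕆'`. -/
abbrev ParaOctonion : Type := CayleyAlgebra 1

namespace CayleyAlgebra

variable {s : ℝ}

instance : NormedAddCommGroup (CayleyAlgebra s) :=
  inferInstanceAs (NormedAddCommGroup (ℍ[ℝ] × ℍ[ℝ]))

instance : NormedSpace ℝ (CayleyAlgebra s) :=
  inferInstanceAs (NormedSpace ℝ (ℍ[ℝ] × ℍ[ℝ]))

instance : FiniteDimensional ℝ (CayleyAlgebra s) :=
  inferInstanceAs (FiniteDimensional ℝ (ℍ[ℝ] × ℍ[ℝ]))

instance : Mul (CayleyAlgebra s) :=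
  ⟨fun x y => (x.1 * y.1 + s • (star y.2 * x.2), y.2 * x.1 + x.2 * star y.1)⟩

instance : One (CayleyAlgebra s) := ⟨((1 : ℍ[ℝ]), (0 : ℍ[ℝ]))⟩

/-- Conjugation. -/
instance : Star (CayleyAlgebra s) := ⟨fun x => (star x.1, -x.2)⟩

/-- Real part. -/
def re (x : CayleyAlgebra s) : ℝ := x.1.re

/-- The inner product `⟨a, b⟩ = Re (a b̄)`. -/
def ip (a b : CayleyAlgebra s) : ℝ := re (a * star b)

/-- `|a|² = ⟨a, a⟩`; it may be negative or zero for a para-octonion `a ≠ 0`. -/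
def normSq (a : CayleyAlgebra s) : ℝ := ip a a

instance : Inv (CayleyAlgebra s) := ⟨fun x => (normSq x)⁻¹ • star x⟩

theorem ext' {x y : CayleyAlgebra s} (h₁ : x.1 = y.1) (h₂ : x.2 = y.2) : x = y :=
  Prod.ext h₁ h₂

@[simp] theorem add_fst (x y : CayleyAlgebra s) : (x + y).1 = x.1 + y.1 := rfl
@[simp] theorem add_snd (x y : CayleyAlgebra s) : (x + y).2 = x.2 + y.2 := rfl
@[simp] theorem zero_fst : (0 : CayleyAlgebra s).1 = 0 := rfl
@[simp] theorem zero_snd : (0 : CayleyAlgebra s).2 = 0 := rfl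
@[simp] theorem smul_fst (r : ℝ) (x : CayleyAlgebra s) : (r • x).1 = r • x.1 := rfl
@[simp] theorem smul_snd (r : ℝ) (x : CayleyAlgebra s) : (r • x).2 = r • x.2 := rfl
@[simp] theorem one_fst : (1 : CayleyAlgebra s).1 = 1 := rfl
@[simp] theorem one_snd : (1 : CayleyAlgebra s).2 = 0 := rfl
@[simp] theorem star_fst (x : CayleyAlgebra s) : (star x).1 = star x.1 := rfl
@[simp] theorem star_snd (x : CayleyAlgebra s) : (star x).2 = -x.2 := rfl
@[simp] theorem mul_fst (x y : CayleyAlgebra s) :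
    (x * y).1 = x.1 * y.1 + s • (star y.2 * x.2) := rfl
@[simp] theorem mul_snd (x y : CayleyAlgebra s) :
    (x * y).2 = y.2 * x.1 + x.2 * star y.1 := rfl

instance : NonAssocRing (CayleyAlgebra s) :=
  { (inferInstance : AddCommGroup (CayleyAlgebra s)) with
    mul := (· * ·)
    one := 1
    left_distrib := fun a b c => ext'
      (by simp [mul_add, add_mul]; abel) (by simp [mul_add, add_mul]; abel)
    right_distrib := fun a b c => ext'
      (by simp [mul_add, add_mul]; abel) (by simp [mul_add, add_mul]; abel)
    zero_mul := fun a => ext' (by simp) (by simp)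
    mul_zero := fun a => ext' (by simp) (by simp)
    one_mul := fun a => ext' (by simp) (by simp)
    mul_one := fun a => ext' (by simp) (by simp) }

instance : IsScalarTower ℝ (CayleyAlgebra s) (CayleyAlgebra s) :=
  ⟨fun r x y => ext' (by simp [smul_smul, mul_comm]) (by simp)⟩

instance : SMulCommClass ℝ (CayleyAlgebra s) (CayleyAlgebra s) :=
  ⟨fun r x y => ext' (by simp [smul_smul, mul_comm]) (by simp)⟩

theorem star_add' (x y : CayleyAlgebra s) : star (x + y) = star x + star y :=
  ext' (by simp) (by simp [add_comm])

theorem star_smul' (r : ℝ) (x : CayleyAlgebra s) : star (r • x) = r • star x :=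
  ext' (by simp) (by simp)

theorem re_add (x y : CayleyAlgebra s) : re (x + y) = re x + re y := by simp [re]

theorem re_smul (r : ℝ) (x : CayleyAlgebra s) : re (r • x) = r * re x := by simp [re]

theorem normSq_eq (x : CayleyAlgebra s) :
    normSq x = Quaternion.normSq x.1 - s * Quaternion.normSq x.2 := by
  simp only [normSq, ip, re, mul_fst, star_fst, star_snd, Quaternion.normSq_def']
  simp
  ring

theorem star_mul' (x y : CayleyAlgebra s) : star (x * y) = star y * star x :=
  ext' (by simp) (by simp [add_comm])

theorem star_mul_mul (x y : CayleyAlgebra s) : star x * (x * y) = normSq x • y := by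
  rw [normSq_eq]
  apply ext' <;> ext <;> simp [Quaternion.normSq_def'] <;> ring

theorem mul_mul_star (x y : CayleyAlgebra s) : y * x * star x = normSq x • y := by
  rw [normSq_eq]
  apply ext' <;> ext <;> simp [Quaternion.normSq_def'] <;> ring

theorem normSq_star (x : CayleyAlgebra s) : normSq (star x) = normSq x := by
  simp [normSq_eq]

theorem star_star' (x : CayleyAlgebra s) : star (star x) = x :=
  ext' (by simp) (by simp)

theorem normSq_mul (x y : CayleyAlgebra s) : normSq (x * y) = normSq x * normSq y := by
  simp only [normSq_eq, Quaternion.normSq_def']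
  simp
  ring

theorem normSq_smul (r : ℝ) (x : CayleyAlgebra s) : normSq (r • x) = r ^ 2 * normSq x := by
  simp only [normSq_eq, Quaternion.normSq_def']
  simp
  ring

theorem normSq_one : normSq (1 : CayleyAlgebra s) = 1 := by simp [normSq_eq]

theorem inv_def (x : CayleyAlgebra s) : x⁻¹ = (normSq x)⁻¹ • star x := rfl

theorem inv_mul_mul {x : CayleyAlgebra s} (hx : 0 < normSq x) (y : CayleyAlgebra s) :
    x⁻¹ * (x * y) = y := by
  rw [inv_def, smul_mul_assoc, star_mul_mul, smul_smul, inv_mul_cancel₀ hx.ne', one_smul]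

theorem mul_mul_inv {x : CayleyAlgebra s} (hx : 0 < normSq x) (y : CayleyAlgebra s) :
    y * x * x⁻¹ = y := by
  rw [inv_def, mul_smul_comm, mul_mul_star, smul_smul, inv_mul_cancel₀ hx.ne', one_smul]

theorem normSq_inv (x : CayleyAlgebra s) : normSq x⁻¹ = (normSq x)⁻¹ := by
  rw [inv_def, normSq_smul, normSq_star]
  rcases eq_or_ne (normSq x) 0 with h | h
  · simp [h]
  · field_simp

theorem inv_inv' {x : CayleyAlgebra s} (hx : 0 < normSq x) : (x⁻¹)⁻¹ = x := by
  rw [inv_def x⁻¹, normSq_inv, inv_inv, inv_def, star_smul', star_star', smul_smul,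
    mul_inv_cancel₀ hx.ne', one_smul]

theorem mul_inv_rev' (x y : CayleyAlgebra s) : (x * y)⁻¹ = y⁻¹ * x⁻¹ := by
  rw [inv_def, inv_def, inv_def, normSq_mul, star_mul', smul_mul_assoc, mul_smul_comm, smul_smul,
    mul_inv, mul_comm (normSq x)⁻¹]

theorem inv_one' : (1 : CayleyAlgebra s)⁻¹ = 1 := by
  rw [inv_def, normSq_one]
  exact ext' (by simp) (by simp)

/-- On the octonions `|a|²` is positive for every `a ≠ 0`. -/
theorem octonion_normSq_pos_iff (a : Octonion) : 0 < normSq a ↔ a ≠ 0 := by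
  rw [normSq_eq]
  have h₁ : 0 ≤ Quaternion.normSq a.1 := Quaternion.normSq_nonneg
  have h₂ : 0 ≤ Quaternion.normSq a.2 := Quaternion.normSq_nonneg
  constructor
  · rintro h rfl
    simp at h
  · intro h
    by_contra hn
    refine h (ext' ?_ ?_)
    · exact Quaternion.normSq_eq_zero.1 (by linarith)
    · exact Quaternion.normSq_eq_zero.1 (by linarith)

theorem continuous_normSq : Continuous (normSq : CayleyAlgebra s → ℝ) := by
  have : (normSq : CayleyAlgebra s → ℝ) = fun x : ℍ[ℝ] × ℍ[ℝ] =>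
      Quaternion.normSq x.1 - s * Quaternion.normSq x.2 := funext normSq_eq
  rw [this]
  exact (Quaternion.continuous_normSq.comp continuous_fst).sub
    (continuous_const.mul (Quaternion.continuous_normSq.comp continuous_snd))

end CayleyAlgebra

/-! ### Curvature of a semi-Riemannian metric -/

section Geometry

variable {E : Type*} [NormedAddCommGroup E] [NormedSpace ℝ E]

/-- The Christoffel symbols of first kind of a metric `G` on (an open subset of) `E`:
`K x u v w = (∂_u G(v, w) + ∂_v G(u, w) - ∂_w G(u, v)) / 2` at `x`. -/
def christoffelLower (G : E → E →L[ℝ] E →L[ℝ] ℝ) (x : E) : E →L[ℝ] E →L[ℝ] E →L[ℝ] ℝ :=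
  (1 / 2 : ℝ) • (fderiv ℝ G x + (fderiv ℝ G x).flip -
    ((ContinuousLinearMap.flipₗᵢ ℝ E E ℝ).toContinuousLinearEquiv :
      (E →L[ℝ] E →L[ℝ] ℝ) →L[ℝ] (E →L[ℝ] E →L[ℝ] ℝ)).comp (fderiv ℝ G x).flip)

theorem christoffelLower_apply (G : E → E →L[ℝ] E →L[ℝ] ℝ) (x u v w : E) :
    christoffelLower G x u v w =
      (fderiv ℝ G x u v w + fderiv ℝ G x v u w - fderiv ℝ G x w u v) / 2 := by
  simp [christoffelLower]
  ring

/-- The Christoffel symbols `Γ x u v` of second kind: the index of `christoffelLower` is raised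
with the inverse of `G x : E → E*`, so that `∇_u v = ∂_u v + Γ(u, v)` is the Levi-Civita
connection of `G`. -/
def christoffel (G : E → E →L[ℝ] E →L[ℝ] ℝ) (x : E) : E →L[ℝ] E →L[ℝ] E :=
  (ContinuousLinearMap.compL ℝ E (E →L[ℝ] ℝ) E (G x).inverse).comp (christoffelLower G x)

theorem christoffel_apply (G : E → E →L[ℝ] E →L[ℝ] ℝ) (x u v : E) :
    christoffel G x u v = (G x).inverse (christoffelLower G x u v) := rfl

/-- The curvature `R(u, v)w` at `x` of the metric `G`, with the sign convention
`R(u, v) = ∇_v ∇_u - ∇_u ∇_v + ∇_[u, v]`. -/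
def curvature (G : E → E →L[ℝ] E →L[ℝ] ℝ) (x u v w : E) : E :=
  fderiv ℝ (christoffel G) x v u w - fderiv ℝ (christoffel G) x u v w
    + christoffel G x v (christoffel G x u w) - christoffel G x u (christoffel G x v w)

/-- The Jacobi operator `J_v(y) = R(v, y)v` at `x` of the metric `G`. -/
def jacobiLocal (G : E → E →L[ℝ] E →L[ℝ] ℝ) (x v : E) : E →ₗ[ℝ] E where
  toFun y := curvature G x v y v
  map_add' y z := by
    simp only [curvature, map_add, add_apply]
    abel
  map_smul' r y := by
    simp only [curvature, map_smul, smul_apply, RingHom.id_apply]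
    module

variable {M : Type*} [TopologicalSpace M] [ChartedSpace E M]

/-- The expression in the chart `e` of a field `g` of bilinear forms on tangent spaces. -/
def localMetric
    (g : ∀ p : M, TangentSpace 𝓘(ℝ, E) p →L[ℝ] TangentSpace 𝓘(ℝ, E) p →L[ℝ] ℝ)
    (e : OpenPartialHomeomorph M E) (x : E) : E →L[ℝ] E →L[ℝ] ℝ :=
  ContinuousLinearMap.bilinearComp (E := E) (F := E) (g (e.symm x) : E →L[ℝ] E →L[ℝ] ℝ)
    (mfderiv 𝓘(ℝ, E) 𝓘(ℝ, E) e.symm x) (mfderiv 𝓘(ℝ, E) 𝓘(ℝ, E) e.symm x)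

/-- `g` is a semi-Riemannian metric: a smooth field of non-degenerate symmetric bilinear forms on
the tangent spaces. -/
structure IsSemiRiemannian
    (g : ∀ p : M, TangentSpace 𝓘(ℝ, E) p →L[ℝ] TangentSpace 𝓘(ℝ, E) p →L[ℝ] ℝ) : Prop where
  symm : ∀ p v w, g p v w = g p w v
  nondegenerate : ∀ p v, (∀ w, g p v w = 0) → v = 0
  smooth : ∀ e ∈ atlas E M, ContDiffOn ℝ ∞ (localMetric g e) e.target

/-- The Jacobi operator `J_v(x) = R(v, x)v` at `p`. It is computed in the preferred chart at `p`,
whose differential at `p` is the identification of `TangentSpace 𝓘(ℝ, E) p` with `E`. -/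
def jacobi
    (g : ∀ p : M, TangentSpace 𝓘(ℝ, E) p →L[ℝ] TangentSpace 𝓘(ℝ, E) p →L[ℝ] ℝ)
    (p : M) (v : TangentSpace 𝓘(ℝ, E) p) : Module.End ℝ (TangentSpace 𝓘(ℝ, E) p) :=
  jacobiLocal (E := E) (localMetric g (chartAt E p)) (chartAt E p p) v

/-- The orthogonal complement `v^⊥`. -/
def perp
    (g : ∀ p : M, TangentSpace 𝓘(ℝ, E) p →L[ℝ] TangentSpace 𝓘(ℝ, E) p →L[ℝ] ℝ)
    (p : M) (v : TangentSpace 𝓘(ℝ, E) p) : Submodule ℝ (TangentSpace 𝓘(ℝ, E) p) :=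
  LinearMap.ker (g p v : TangentSpace 𝓘(ℝ, E) p →ₗ[ℝ] ℝ)

/-- Unit vectors, spacelike or timelike: `g(v, v) = 1` or `g(v, v) = -1`. -/
def IsUnitVector
    (g : ∀ p : M, TangentSpace 𝓘(ℝ, E) p →L[ℝ] TangentSpace 𝓘(ℝ, E) p →L[ℝ] ℝ)
    (p : M) (v : TangentSpace 𝓘(ℝ, E) p) : Prop :=
  g p v v = 1 ∨ g p v v = -1

/-- `ker (J_v - ε_v c Id)`, where `ε_v = g(v, v)`. -/
def jacobiEigenspace
    (g : ∀ p : M, TangentSpace 𝓘(ℝ, E) p →L[ℝ] TangentSpace 𝓘(ℝ, E) p →L[ℝ] ℝ)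
    (c : ℝ) (p : M) (v : TangentSpace 𝓘(ℝ, E) p) : Submodule ℝ (TangentSpace 𝓘(ℝ, E) p) :=
  (jacobi g p v).eigenspace (g p v v * c)

/-- `E_c(v) = span {v} ⊕ ker (J_v - ε_v c Id)`. -/
def extendedEigenspace
    (g : ∀ p : M, TangentSpace 𝓘(ℝ, E) p →L[ℝ] TangentSpace 𝓘(ℝ, E) p →L[ℝ] ℝ)
    (c : ℝ) (p : M) (v : TangentSpace 𝓘(ℝ, E) p) : Submodule ℝ (TangentSpace 𝓘(ℝ, E) p) :=
  Submodule.span ℝ {v} ⊔ jacobiEigenspace g c p v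

/-- `(M, g)` is a special Osserman manifold, and the constants in its defining conditions are
`lam` and `mu`. -/
structure IsSpecialOssermanWith
    (g : ∀ p : M, TangentSpace 𝓘(ℝ, E) p →L[ℝ] TangentSpace 𝓘(ℝ, E) p →L[ℝ] ℝ)
    (lam mu : ℝ) : Prop where
  isSemiRiemannian : IsSemiRiemannian g
  lam_ne_zero : lam ≠ 0
  mu_ne_zero : mu ≠ 0
  lam_ne_mu : lam ≠ mu
  /-- Condition (I): `J_v` maps `v^⊥` to itself, this restriction is diagonalizable, and its
  non-zero eigenvalues are exactly `ε_v lam` and `ε_v mu`. -/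
  condition_one : ∀ p v, IsUnitVector g p v →
    ∃ h : ∀ x ∈ perp g p v, jacobi g p v x ∈ perp g p v,
      (⨆ c : ℝ, Module.End.eigenspace ((jacobi g p v).restrict h) c) = ⊤ ∧
      ∀ c : ℝ, c ≠ 0 → (Module.End.HasEigenvalue ((jacobi g p v).restrict h) c ↔
        c = g p v v * lam ∨ c = g p v v * mu)
  /-- Condition (II). -/
  condition_two : ∀ p v w, IsUnitVector g p v → IsUnitVector g p w →
    w ∈ extendedEigenspace g lam p v → extendedEigenspace g lam p v = extendedEigenspace g lam p w
  /-- Condition (III); `w` is not required to be a unit vector. -/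
  condition_three : ∀ p v w, IsUnitVector g p v →
    w ∈ jacobiEigenspace g mu p v → v ∈ jacobiEigenspace g mu p w

/-- For every unit `v`, the eigenvalue `ε_v c` of `J_v : v^⊥ → v^⊥` has multiplicity `k`. -/
def HasMultiplicity
    (g : ∀ p : M, TangentSpace 𝓘(ℝ, E) p →L[ℝ] TangentSpace 𝓘(ℝ, E) p →L[ℝ] ℝ)
    (c : ℝ) (k : ℕ) : Prop :=
  ∀ p v, IsUnitVector g p v → Module.finrank ℝ ↥(jacobiEigenspace g c p v ⊓ perp g p v) = k

end Geometry

/-! ### The planes -/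

namespace CayleyAlgebra

variable {s : ℝ}

theorem contDiff_mul : ContDiff ℝ ∞ fun x : CayleyAlgebra s × CayleyAlgebra s => x.1 * x.2 :=
  (LinearMap.mul ℝ (CayleyAlgebra s)).toContinuousBilinearMap.isBoundedBilinearMap.contDiff

instance : ContinuousMul (CayleyAlgebra s) := ⟨contDiff_mul.continuous⟩

theorem contDiff_star : ContDiff ℝ ∞ (star : CayleyAlgebra s → CayleyAlgebra s) :=
  (LinearMap.toContinuousLinearMap
    ({ toFun := star, map_add' := star_add', map_smul' := star_smul' } :
      CayleyAlgebra s →ₗ[ℝ] CayleyAlgebra s)).contDiff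

theorem contDiff_re : ContDiff ℝ ∞ (re : CayleyAlgebra s → ℝ) :=
  (LinearMap.toContinuousLinearMap
    ({ toFun := re, map_add' := re_add, map_smul' := re_smul } : CayleyAlgebra s →ₗ[ℝ] ℝ)).contDiff

theorem contDiff_normSq : ContDiff ℝ ∞ (normSq : CayleyAlgebra s → ℝ) :=
  contDiff_re.comp (contDiff_mul.comp (contDiff_id.prodMk contDiff_star))

end CayleyAlgebra

open CayleyAlgebra

/-- The set `U_i` of reduced homogeneous coordinates: the triples `a` with `a_i = 1` and
`|a₁|² + |a₂|² + |a₃|² > 0`. For octonions the second condition holds automatically. -/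
def reducedTriples (s : ℝ) (i : Fin 3) : Set (Fin 3 → CayleyAlgebra s) :=
  {a | a i = 1 ∧ 0 < ∑ j, normSq (a j)}

/-- `[a] ∼ [b]` if `a = b λ` for some `λ` with `|λ|² > 0`; for octonions this means `λ ≠ 0`. -/
def ProjRel {s : ℝ} (a b : Fin 3 → CayleyAlgebra s) : Prop :=
  ∃ l : CayleyAlgebra s, 0 < normSq l ∧ ∀ j, a j = b j * l

theorem projRel_iff {s : ℝ} {i : Fin 3} {a b : Fin 3 → CayleyAlgebra s} (ha : a i = 1) :
    ProjRel a b ↔ 0 < normSq (b i) ∧ ∀ j, a j = b j * (b i)⁻¹ := by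
  constructor
  · rintro ⟨l, hl, h⟩
    have hb : b i = l⁻¹ := by
      have := mul_mul_inv hl (b i)
      rw [← h i, ha, one_mul] at this
      exact this.symm
    refine ⟨by rw [hb, normSq_inv]; exact inv_pos.2 hl, fun j => ?_⟩
    rw [hb, inv_inv' hl, h j]
  · rintro ⟨hb, h⟩
    exact ⟨(b i)⁻¹, by rw [normSq_inv]; exact inv_pos.2 hb, h⟩

theorem projRel_symm {s : ℝ} {a b : Fin 3 → CayleyAlgebra s} (h : ProjRel a b) : ProjRel b a := by
  obtain ⟨l, hl, h⟩ := h
  exact ⟨l⁻¹, by rw [normSq_inv]; exact inv_pos.2 hl, fun j => by rw [h j, mul_mul_inv hl]⟩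

theorem projRel_trans {s : ℝ} {i j k : Fin 3} {a b c : Fin 3 → CayleyAlgebra s} (ha : a i = 1)
    (hb : b j = 1) (hc : c k = 1) (hab : ProjRel a b) (hbc : ProjRel b c) : ProjRel a c := by
  rw [projRel_iff ha] at hab ⊢
  rw [projRel_iff hb] at hbc
  obtain ⟨hbi, hab⟩ := hab
  obtain ⟨hcj, hbc⟩ := hbc
  have hci : 0 < normSq (c i) := by
    rw [hbc i, normSq_mul, normSq_inv] at hbi
    exact (pos_iff_pos_of_mul_pos hbi).2 (inv_pos.2 hcj)
  refine ⟨hci, fun m => ?_⟩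
  have key : a m = c m * (c j)⁻¹ * (c j * (c i)⁻¹) := by
    rw [hab m, hbc m, hbc i, mul_inv_rev', inv_inv' hcj]
  have e₁ : c j * (c j)⁻¹ = 1 := by simpa using mul_mul_inv hcj 1
  have e₂ : c i * (c i)⁻¹ = 1 := by simpa using mul_mul_inv hci 1
  have e₃ : ∀ x : CayleyAlgebra s, (c j)⁻¹ * (c j * x) = x := inv_mul_mul hcj
  have e₄ : ∀ x : CayleyAlgebra s, x * (c j)⁻¹ * c j = x := fun x => by
    have h := mul_mul_inv (x := (c j)⁻¹) (by rw [normSq_inv]; exact inv_pos.2 hcj) x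
    rwa [inv_inv' hcj] at h
  rw [key]
  by_cases hmj : m = j
  · subst hmj
    rw [e₁, one_mul]
  by_cases hmi : m = i
  · subst hmi
    have h := mul_mul_inv (x := c m * (c j)⁻¹)
      (by rw [normSq_mul, normSq_inv]; exact mul_pos hci (inv_pos.2 hcj)) 1
    rw [mul_inv_rev', inv_inv' hcj, one_mul] at h
    rw [h, e₂]
  by_cases hij : i = j
  · subst hij
    rw [e₂, mul_one]
  have hk : k = m ∨ k = j ∨ k = i := by omega
  rcases hk with rfl | rfl | rfl
  · rw [hc, one_mul, one_mul, e₃]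
  · rw [hc, inv_one', mul_one, one_mul]
  · rw [hc, inv_one', mul_one, mul_one, e₄]

/-- The equivalence relation `∼` on `𝒰 = U₁ ∪ U₂ ∪ U₃`. -/
def planeSetoid (s : ℝ) : Setoid ↥(⋃ i, reducedTriples s i) where
  r a b := ProjRel a.1 b.1
  iseqv :=
    { refl := fun a => ⟨1, by rw [normSq_one]; exact one_pos, fun j => by rw [mul_one]⟩
      symm := projRel_symm
      trans := fun {a b c} hab hbc => by
        obtain ⟨i, hi⟩ := Set.mem_iUnion.1 a.2
        obtain ⟨j, hj⟩ := Set.mem_iUnion.1 b.2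
        obtain ⟨k, hk⟩ := Set.mem_iUnion.1 c.2
        exact projRel_trans hi.1 hj.1 hk.1 hab hbc }

/-- The projective plane `𝒰 / ∼`. -/
def Plane (s : ℝ) : Type := Quotient (planeSetoid s)

/-- The class `[a₁, a₂, a₃]`. -/
def Plane.mk {s : ℝ} (a : ↥(⋃ i, reducedTriples s i)) : Plane s := Quotient.mk (planeSetoid s) a

theorem Plane.mk_eq_mk {s : ℝ} {a b : ↥(⋃ i, reducedTriples s i)} :
    Plane.mk a = Plane.mk b ↔ ProjRel a.1 b.1 :=
  Quotient.eq (r := planeSetoid s)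

/-- The octonionic projective plane `𝕆P²`. -/
abbrev OctonionicPlane : Type := Plane (-1)

/-- The para-octonionic projective plane `𝕆'P²`. -/
abbrev ParaOctonionicPlane : Type := Plane 1

/-- The common image `{(u, v) : 1 + |u|² + |v|² > 0}` of the three charts. -/
def coordDomain (s : ℝ) : Set (CayleyAlgebra s × CayleyAlgebra s) :=
  {x | 0 < 1 + normSq x.1 + normSq x.2}

/-- For octonions the charts are onto `𝕆²`. -/
theorem coordDomain_octonion : coordDomain (-1) = Set.univ := by
  refine Set.eq_univ_of_forall fun x => ?_
  have h : ∀ a : Octonion, 0 ≤ normSq a := fun a => by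
    rcases eq_or_ne a 0 with rfl | ha
    · simp [normSq_eq]
    · exact ((octonion_normSq_pos_iff a).2 ha).le
  have h₁ := h x.1
  have h₂ := h x.2
  simp only [coordDomain, Set.mem_ofPred_eq]
  linarith

/-- The triples `(1, u, v)`, `(u, 1, v)`, `(u, v, 1)`. -/
def triple {s : ℝ} (i : Fin 3) (x : CayleyAlgebra s × CayleyAlgebra s) : Fin 3 → CayleyAlgebra s :=
  match i with
  | 0 => ![1, x.1, x.2]
  | 1 => ![x.1, 1, x.2]
  | 2 => ![x.1, x.2, 1]

theorem triple_self {s : ℝ} (i : Fin 3) (x : CayleyAlgebra s × CayleyAlgebra s) :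
    triple i x i = 1 := by
  fin_cases i <;> rfl

theorem sum_normSq_triple {s : ℝ} (i : Fin 3) (x : CayleyAlgebra s × CayleyAlgebra s) :
    ∑ j, normSq (triple i x j) = 1 + normSq x.1 + normSq x.2 := by
  fin_cases i <;> simp [triple, Fin.sum_univ_three, normSq_one] <;> ring

theorem triple_mem {s : ℝ} (i : Fin 3) {x : CayleyAlgebra s × CayleyAlgebra s}
    (hx : x ∈ coordDomain s) : triple i x ∈ ⋃ i, reducedTriples s i :=
  Set.mem_iUnion.2 ⟨i, triple_self i x, by rw [sum_normSq_triple]; exact hx⟩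

theorem zero_mem_coordDomain {s : ℝ} : (0 : CayleyAlgebra s × CayleyAlgebra s) ∈ coordDomain s := by
  simp [coordDomain, normSq_eq]

open Classical in
/-- The inverse of the `i`-th chart: `(u, v)` is sent to the class of `(1, u, v)`, `(u, 1, v)` or
`(u, v, 1)`. The value outside of `coordDomain s` is irrelevant. -/
def ofCoord {s : ℝ} (i : Fin 3) (x : CayleyAlgebra s × CayleyAlgebra s) : Plane s :=
  if h : x ∈ coordDomain s then Plane.mk ⟨triple i x, triple_mem i h⟩
  else Plane.mk ⟨triple i 0, triple_mem i zero_mem_coordDomain⟩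

theorem ofCoord_eq_iff {s : ℝ} {i j : Fin 3} {x y : CayleyAlgebra s × CayleyAlgebra s}
    (hx : x ∈ coordDomain s) (hy : y ∈ coordDomain s) :
    ofCoord i x = ofCoord j y ↔ ProjRel (triple i x) (triple j y) := by
  rw [ofCoord, ofCoord, dif_pos hx, dif_pos hy, Plane.mk_eq_mk]

/-- The two coordinates of a triple other than the `i`-th one. -/
def affinePart {s : ℝ} (i : Fin 3) (a : Fin 3 → CayleyAlgebra s) :
    CayleyAlgebra s × CayleyAlgebra s :=
  match i with
  | 0 => (a 1, a 2)
  | 1 => (a 0, a 2)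
  | 2 => (a 0, a 1)

theorem affinePart_triple {s : ℝ} (i : Fin 3) (x : CayleyAlgebra s × CayleyAlgebra s) :
    affinePart i (triple i x) = x := by
  fin_cases i <;> rfl

theorem triple_affinePart {s : ℝ} (i : Fin 3) {a : Fin 3 → CayleyAlgebra s} (ha : a i = 1) :
    triple i (affinePart i a) = a := by
  ext j : 1
  fin_cases i <;> fin_cases j <;> first | rfl | exact ha.symm

/-- The transition maps `φ_j ∘ φ_i⁻¹`. -/
def transition {s : ℝ} (i j : Fin 3) (x : CayleyAlgebra s × CayleyAlgebra s) :
    CayleyAlgebra s × CayleyAlgebra s :=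
  affinePart j fun m => triple i x m * (triple i x j)⁻¹

theorem triple_transition {s : ℝ} {i j : Fin 3} {x : CayleyAlgebra s × CayleyAlgebra s}
    (h : 0 < normSq (triple i x j)) :
    triple j (transition i j x) = fun m => triple i x m * (triple i x j)⁻¹ :=
  triple_affinePart j (by simpa using mul_mul_inv h 1)

theorem transition_mem {s : ℝ} {i j : Fin 3} {x : CayleyAlgebra s × CayleyAlgebra s}
    (hx : x ∈ coordDomain s) (h : 0 < normSq (triple i x j)) :
    transition i j x ∈ coordDomain s := by
  have hx' : 0 < 1 + normSq x.1 + normSq x.2 := hx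
  rw [← sum_normSq_triple i] at hx'
  have : 0 < ∑ m, normSq (triple j (transition i j x) m) := by
    rw [triple_transition h]
    simp only [normSq_mul, ← Finset.sum_mul, normSq_inv]
    exact mul_pos hx' (inv_pos.2 h)
  rwa [sum_normSq_triple] at this

theorem ofCoord_eq_iff_transition {s : ℝ} {i j : Fin 3} {x y : CayleyAlgebra s × CayleyAlgebra s}
    (hx : x ∈ coordDomain s) (hy : y ∈ coordDomain s) :
    ofCoord i x = ofCoord j y ↔ 0 < normSq (triple i x j) ∧ y = transition i j x := by
  rw [eq_comm, ofCoord_eq_iff hy hx, projRel_iff (triple_self j y)]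
  refine and_congr_right fun h => ?_
  constructor
  · intro H
    rw [← affinePart_triple j y, funext H]
    rfl
  · rintro rfl m
    rw [triple_transition h]

theorem ofCoord_injOn {s : ℝ} (i : Fin 3) : Set.InjOn (ofCoord (s := s) i) (coordDomain s) := by
  intro x hx y hy h
  rw [((ofCoord_eq_iff_transition hx hy).1 h).2, transition]
  simp only [triple_self, inv_one', mul_one]
  exact (affinePart_triple i x).symm

/-- The chart `φ_i : U_i/∼ → 𝔸²`: `φ₁[1, b, c] = (b, c)`, `φ₂[a, 1, c] = (a, c)`,
`φ₃[a, b, 1] = (a, b)`. -/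
def planeChart (s : ℝ) (i : Fin 3) : PartialEquiv (Plane s) (CayleyAlgebra s × CayleyAlgebra s) :=
  (Set.InjOn.toPartialEquiv (ofCoord i) (coordDomain s) (ofCoord_injOn i)).symm

theorem planeChart_target (s : ℝ) (i : Fin 3) : (planeChart s i).target = coordDomain s := rfl

theorem planeChart_source (s : ℝ) (i : Fin 3) :
    (planeChart s i).source = ofCoord i '' coordDomain s := rfl

theorem planeChart_symm_apply (s : ℝ) (i : Fin 3) (x : CayleyAlgebra s × CayleyAlgebra s) :
    (planeChart s i).symm x = ofCoord i x := rfl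

theorem planeChart_trans_source (s : ℝ) (i j : Fin 3) :
    ((planeChart s i).symm.trans (planeChart s j)).source =
      coordDomain s ∩ {x | 0 < normSq (triple i x j)} := by
  ext x
  simp only [PartialEquiv.trans_source, PartialEquiv.symm_source, planeChart_target,
    Set.mem_inter_iff, Set.mem_preimage, planeChart_symm_apply, planeChart_source, Set.mem_image,
    Set.mem_ofPred_eq]
  refine and_congr_right fun hx => ?_
  constructor
  · rintro ⟨y, hy, h⟩
    exact ((ofCoord_eq_iff_transition hx hy).1 h.symm).1
  · intro h
    exact ⟨transition i j x, transition_mem hx h,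
      ((ofCoord_eq_iff_transition hx (transition_mem hx h)).2 ⟨h, rfl⟩).symm⟩

theorem planeChart_trans_eqOn (s : ℝ) (i j : Fin 3) :
    Set.EqOn ((planeChart s i).symm.trans (planeChart s j)) (transition i j)
      (coordDomain s ∩ {x | 0 < normSq (triple i x j)}) := by
  rintro x ⟨hx, h⟩
  have h' : ofCoord i x = ofCoord j (transition i j x) :=
    (ofCoord_eq_iff_transition hx (transition_mem hx h)).2 ⟨h, rfl⟩
  change planeChart s j (ofCoord i x) = _
  rw [h', ← planeChart_symm_apply]
  exact (planeChart s j).right_inv (transition_mem hx h)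

theorem contDiff_triple {s : ℝ} (i j : Fin 3) :
    ContDiff ℝ ∞ fun x : CayleyAlgebra s × CayleyAlgebra s => triple i x j := by
  fin_cases i <;> fin_cases j <;>
    first | exact contDiff_const | exact contDiff_fst | exact contDiff_snd

theorem isOpen_coordDomain (s : ℝ) : IsOpen (coordDomain s) :=
  isOpen_lt continuous_const ((continuous_const.add (continuous_normSq.comp continuous_fst)).add
    (continuous_normSq.comp continuous_snd))

theorem isOpen_transition_source (s : ℝ) (i j : Fin 3) :
    IsOpen (coordDomain s ∩ {x | 0 < normSq (triple i x j)}) :=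
  (isOpen_coordDomain s).inter
    (isOpen_lt continuous_const (continuous_normSq.comp (contDiff_triple i j).continuous))

theorem contDiffOn_transition (s : ℝ) (i j : Fin 3) :
    ContDiffOn ℝ ∞ (transition i j)
      (coordDomain s ∩ {x : CayleyAlgebra s × CayleyAlgebra s | 0 < normSq (triple i x j)}) := by
  have h : ∀ m, ContDiffOn ℝ ∞
      (fun x : CayleyAlgebra s × CayleyAlgebra s => triple i x m * (triple i x j)⁻¹)
      (coordDomain s ∩ {x | 0 < normSq (triple i x j)}) := fun m =>
    contDiff_mul.comp_contDiffOn ((contDiff_triple i m).contDiffOn.prodMk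
      (((contDiff_normSq.comp (contDiff_triple i j)).contDiffOn.inv fun x hx => hx.2.ne').smul
        (contDiff_star.comp (contDiff_triple i j)).contDiffOn))
  fin_cases j
  · exact (h 1).prodMk (h 2)
  · exact (h 0).prodMk (h 2)
  · exact (h 0).prodMk (h 1)

theorem exists_mem_planeChart_source {s : ℝ} (p : Plane s) : ∃ i, p ∈ (planeChart s i).source := by
  obtain ⟨⟨a, ha⟩, rfl⟩ := Quotient.exists_rep p
  obtain ⟨i, hi, hpos⟩ := Set.mem_iUnion.1 ha
  have hx : affinePart i a ∈ coordDomain s := by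
    rw [← triple_affinePart i hi, sum_normSq_triple] at hpos
    exact hpos
  refine ⟨i, affinePart i a, hx, ?_⟩
  rw [ofCoord, dif_pos hx]
  exact congrArg Plane.mk (Subtype.ext (triple_affinePart i hi))

/-- The atlas `{φ₁, φ₂, φ₃}`. -/
def planeCore (s : ℝ) : ChartedSpaceCore (CayleyAlgebra s × CayleyAlgebra s) (Plane s) where
  atlas := Set.range (planeChart s)
  chartAt p := planeChart s (exists_mem_planeChart_source p).choose
  mem_chart_source p := (exists_mem_planeChart_source p).choose_spec
  chart_mem_atlas p := ⟨_, rfl⟩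
  open_source := by
    rintro _ _ ⟨i, rfl⟩ ⟨j, rfl⟩
    rw [planeChart_trans_source]
    exact isOpen_transition_source s i j
  continuousOn_toFun := by
    rintro _ _ ⟨i, rfl⟩ ⟨j, rfl⟩
    rw [planeChart_trans_source]
    exact (contDiffOn_transition s i j).continuousOn.congr (planeChart_trans_eqOn s i j)

instance (s : ℝ) : TopologicalSpace (Plane s) := (planeCore s).toTopologicalSpace

instance (s : ℝ) : ChartedSpace (CayleyAlgebra s × CayleyAlgebra s) (Plane s) :=
  (planeCore s).toChartedSpace

/-- The chart `φ_i` as a homeomorphism between open sets. -/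
def planeHomeo (s : ℝ) (i : Fin 3) :
    OpenPartialHomeomorph (Plane s) (CayleyAlgebra s × CayleyAlgebra s) :=
  (planeCore s).openPartialHomeomorph (planeChart s i) ⟨i, rfl⟩

theorem mem_atlas_plane_iff {s : ℝ}
    (e : OpenPartialHomeomorph (Plane s) (CayleyAlgebra s × CayleyAlgebra s)) :
    e ∈ atlas (CayleyAlgebra s × CayleyAlgebra s) (Plane s) ↔ ∃ i, e = planeHomeo s i := by
  change e ∈ ⋃ (f : PartialEquiv _ _) (hf : f ∈ (planeCore s).atlas), {_} ↔ _
  simp only [Set.mem_iUnion, Set.mem_singleton_iff]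
  constructor
  · rintro ⟨_, ⟨i, rfl⟩, h⟩
    exact ⟨i, h⟩
  · rintro ⟨i, h⟩
    exact ⟨_, ⟨i, rfl⟩, h⟩

instance (s : ℝ) : IsManifold 𝓘(ℝ, CayleyAlgebra s × CayleyAlgebra s) ∞ (Plane s) := by
  apply isManifold_of_contDiffOn
  intro e e' he he'
  obtain ⟨i, rfl⟩ := (mem_atlas_plane_iff e).1 he
  obtain ⟨j, rfl⟩ := (mem_atlas_plane_iff e').1 he'
  have hs : ((planeHomeo s i).symm ≫ₕ planeHomeo s j).source =
      coordDomain s ∩ {x | 0 < normSq (triple i x j)} := planeChart_trans_source s i j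
  simp only [modelWithCornersSelf_coe, modelWithCornersSelf_coe_symm, Set.preimage_id_eq, id_eq,
    Set.range_id, Set.inter_univ, Function.comp_id, Function.id_comp]
  rw [hs]
  exact (contDiffOn_transition s i j).congr (planeChart_trans_eqOn s i j)

theorem projRel_eq {s : ℝ} {i j : Fin 3} {x y : CayleyAlgebra s × CayleyAlgebra s}
    (h : ProjRel (triple i x) (triple j y)) :
    0 < normSq (triple i x j) ∧ ∀ m, triple i x m = triple j y m * triple i x j := by
  obtain ⟨l, hl, h⟩ := h
  have : triple i x j = l := by rw [h j, triple_self, one_mul]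
  rw [this]
  exact ⟨hl, h⟩

instance (s : ℝ) : T2Space (Plane s) := by
  rw [t2_iff_ultrafilter]
  intro p q f hp hq
  obtain ⟨i, hi⟩ := exists_mem_planeChart_source p
  obtain ⟨j, hj⟩ := exists_mem_planeChart_source q
  have hip : p ∈ (planeHomeo s i).source := hi
  have hjq : q ∈ (planeHomeo s j).source := hj
  have tx : Filter.Tendsto (planeHomeo s i) f (nhds (planeHomeo s i p)) :=
    ((planeHomeo s i).continuousAt hip).mono_left hp
  have ty : Filter.Tendsto (planeHomeo s j) f (nhds (planeHomeo s j q)) :=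
    ((planeHomeo s j).continuousAt hjq).mono_left hq
  have ei : ∀ r ∈ (planeHomeo s i).source, ofCoord i (planeHomeo s i r) = r :=
    fun r hr => (planeHomeo s i).left_inv hr
  have ej : ∀ r ∈ (planeHomeo s j).source, ofCoord j (planeHomeo s j r) = r :=
    fun r hr => (planeHomeo s j).left_inv hr
  have di : ∀ r ∈ (planeHomeo s i).source, planeHomeo s i r ∈ coordDomain s :=
    fun r hr => (planeHomeo s i).map_source hr
  have dj : ∀ r ∈ (planeHomeo s j).source, planeHomeo s j r ∈ coordDomain s :=
    fun r hr => (planeHomeo s j).map_source hr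
  have ev : ∀ᶠ r in (f : Filter (Plane s)), 0 < normSq (triple i (planeHomeo s i r) j) ∧
      ∀ m, triple i (planeHomeo s i r) m =
        triple j (planeHomeo s j r) m * triple i (planeHomeo s i r) j := by
    filter_upwards [hp ((planeHomeo s i).open_source.mem_nhds hip),
      hq ((planeHomeo s j).open_source.mem_nhds hjq)] with r hr hr'
    have he : ofCoord i (planeHomeo s i r) = ofCoord j (planeHomeo s j r) :=
      (ei r hr).trans (ej r hr').symm
    exact projRel_eq ((ofCoord_eq_iff (di r hr) (dj r hr')).1 he)
  have lx : ∀ m, Filter.Tendsto (fun r => triple i (planeHomeo s i r) m) f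
      (nhds (triple i (planeHomeo s i p) m)) := fun m =>
    ((contDiff_triple i m).continuous.tendsto _).comp tx
  have ly : ∀ m, Filter.Tendsto (fun r => triple j (planeHomeo s j r) m) f
      (nhds (triple j (planeHomeo s j q) m)) := fun m =>
    ((contDiff_triple j m).continuous.tendsto _).comp ty
  have hm : ∀ m, triple i (planeHomeo s i p) m =
      triple j (planeHomeo s j q) m * triple i (planeHomeo s i p) j := fun m =>
    tendsto_nhds_unique_of_eventuallyEq (lx m)
      ((ly m).mul (lx j))
      (ev.mono fun r hr => hr.2 m)
  have tn : Filter.Tendsto (fun r => normSq (triple i (planeHomeo s i r) j)) f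
      (nhds (normSq (triple i (planeHomeo s i p) j))) :=
    (continuous_normSq.tendsto (triple i (planeHomeo s i p) j)).comp (lx j)
  have h0 : 0 ≤ normSq (triple i (planeHomeo s i p) j) :=
    ge_of_tendsto tn (ev.mono fun r hr => hr.1.le)
  have h1 : normSq (triple i (planeHomeo s i p) j) ≠ 0 := fun h => by
    have := congrArg normSq (hm i)
    rw [triple_self, normSq_mul, h, mul_zero, normSq_one] at this
    exact one_ne_zero this
  rw [← ei p hip, ← ej q hjq, ofCoord_eq_iff (di p hip) (dj q hjq)]
  exact ⟨_, lt_of_le_of_ne h0 h1.symm, hm⟩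

instance (s : ℝ) : SecondCountableTopology (Plane s) := by
  have hc : (⋃ i, (planeHomeo s i).source) = Set.univ :=
    Set.eq_univ_of_forall fun p => Set.mem_iUnion.2 (exists_mem_planeChart_source p)
  have : ∀ i, SecondCountableTopology ((planeHomeo s i).source) := fun i =>
    (planeHomeo s i).secondCountableTopology_source
  exact TopologicalSpace.secondCountableTopology_of_countable_cover
    (fun i => (planeHomeo s i).open_source) hc

/-- The symmetric bilinear form at `(u, v)` whose quadratic form is
`(|du|² (1 + k|v|²) + |dv|² (1 + k|u|²) - 2k Re ((u v̄) (dv dū))) / (1 + k|u|² + k|v|²)²`. -/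
def fubiniStudyForm {s : ℝ} (k : ℝ) (x : CayleyAlgebra s × CayleyAlgebra s) :
    (CayleyAlgebra s × CayleyAlgebra s) →L[ℝ] (CayleyAlgebra s × CayleyAlgebra s) →L[ℝ] ℝ :=
  LinearMap.toContinuousBilinearMap <| LinearMap.mk₂ ℝ
    (fun a b => (ip a.1 b.1 * (1 + k * normSq x.2) + ip a.2 b.2 * (1 + k * normSq x.1)
      - k * (re ((x.1 * star x.2) * (a.2 * star b.1)) + re ((x.1 * star x.2) * (b.2 * star a.1))))
        / (1 + k * normSq x.1 + k * normSq x.2) ^ 2)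
    (fun a a' b => by
      simp only [Prod.fst_add, Prod.snd_add, ip, star_add', add_mul, mul_add, re_add]; ring)
    (fun r a b => by
      simp only [Prod.smul_fst, Prod.smul_snd, ip, star_smul', smul_mul_assoc, mul_smul_comm,
        re_smul, smul_eq_mul]
      ring)
    (fun a b b' => by
      simp only [Prod.fst_add, Prod.snd_add, ip, star_add', add_mul, mul_add, re_add]; ring)
    (fun r a b => by
      simp only [Prod.smul_fst, Prod.smul_snd, ip, star_smul', smul_mul_assoc, mul_smul_comm,
        re_smul, smul_eq_mul]
      ring)

theorem fubiniStudyForm_apply {s : ℝ} (k : ℝ) (x a b : CayleyAlgebra s × CayleyAlgebra s) :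
    fubiniStudyForm k x a b =
      (ip a.1 b.1 * (1 + k * normSq x.2) + ip a.2 b.2 * (1 + k * normSq x.1)
      - k * (re ((x.1 * star x.2) * (a.2 * star b.1)) + re ((x.1 * star x.2) * (b.2 * star a.1))))
        / (1 + k * normSq x.1 + k * normSq x.2) ^ 2 := rfl

/-- The formula for `ds²` in the coordinates `(u, v)`, at the tangent vector `(du, dv)`. -/
theorem fubiniStudyForm_self {s : ℝ} (u v du dv : CayleyAlgebra s) :
    fubiniStudyForm 1 (u, v) (du, dv) (du, dv) =
      (normSq du * (1 + normSq v) + normSq dv * (1 + normSq u)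
        - 2 * re ((u * star v) * (dv * star du))) / (1 + normSq u + normSq v) ^ 2 := by
  simp only [fubiniStudyForm_apply, normSq]
  ring

/-- The formula for `ds²` on the hyperbolic plane. -/
theorem fubiniStudyForm_neg_one_self {s : ℝ} (u v du dv : CayleyAlgebra s) :
    fubiniStudyForm (-1) (u, v) (du, dv) (du, dv) =
      (normSq du * (1 - normSq v) + normSq dv * (1 - normSq u)
        + 2 * re ((u * star v) * (dv * star du))) / (1 - normSq u - normSq v) ^ 2 := by
  simp only [fubiniStudyForm_apply, normSq]
  ring

/-- The metric of the projective plane: in the coordinates of the preferred chart at `p`, it is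
given at `p` by `fubiniStudyForm 1`. -/
def planeMetric (s : ℝ) (p : Plane s) :
    TangentSpace 𝓘(ℝ, CayleyAlgebra s × CayleyAlgebra s) p →L[ℝ]
      TangentSpace 𝓘(ℝ, CayleyAlgebra s × CayleyAlgebra s) p →L[ℝ] ℝ :=
  fubiniStudyForm 1 (chartAt (CayleyAlgebra s × CayleyAlgebra s) p p)

/-- The octonionic hyperbolic plane `𝕆H² = {(u, v) ∈ 𝕆² : |u|² + |v|² < 1}`, an open submanifold
of `𝕆²`. -/
def HyperbolicPlane : TopologicalSpace.Opens (Octonion × Octonion) where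
  carrier := {x | normSq x.1 + normSq x.2 < 1}
  is_open' := isOpen_lt ((continuous_normSq.comp continuous_fst).add
    (continuous_normSq.comp continuous_snd)) continuous_const

/-- The metric of `𝕆H²`. -/
def hyperbolicMetric (p : HyperbolicPlane) :
    TangentSpace 𝓘(ℝ, Octonion × Octonion) p →L[ℝ]
      TangentSpace 𝓘(ℝ, Octonion × Octonion) p →L[ℝ] ℝ :=
  fubiniStudyForm (-1) p.1

end

/-!
Let `k = 1` for the projective planes and `k = -1` for the hyperbolic plane. On the pairs over the
Cayley algebra, let `2 a a*` denote twice the column `a` times its conjugate row, acting as a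
Hermitian matrix; for `|a|² ≠ 0` it is `2 |a|²` times the projection onto the octonionic line
through `a`. The polarizations of these operators satisfy a few identities that replace
associativity, and that survive when the bilinear form is twisted by a suitable Hermitian operator.

The metric at `x` is such a twist of the flat form, by
`(1 + k |x|²)⁻¹ - k (1 + k |x|²)⁻² x x*`, and its Christoffel symbol is `-k (1 + k |x|²)⁻¹ {a x b}`
for a triple product `{a x b}` built from the same operators. The identities then collapse the
Jacobi operator at every `x` to `k (|v|² + 3 v v* - 4 ⟨v, ·⟩ v)`, with all terms read in the twisted
structure. On `v^⊥` it is `4 k |v|²` along the line through `v` and `k |v|²` on the orthogonal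
complement of that line. Condition (II) says that lines with a common non-null vector coincide, and
condition (III) that orthogonality of lines is symmetric.

The transition maps between the charts are compositions of `(u, v) ↦ (v, u)` and
`(u, v) ↦ (u⁻¹, v u⁻¹)`, and both are isometries for the metric with `k = 1`.
-/

noncomputable section

open CayleyAlgebra

/-! ### Line systems -/

/-- The axiomatics of the affine plane over a composition algebra of dimension `d`: a nondegenerate
symmetric form and, for each vector `v`, the operator `op v v`, which stands for `2 |v|²` times the
orthogonal projection onto the `d`-dimensional line through `v`; `op a b` is its polarization. -/
structure LineSystem (V : Type*) [AddCommGroup V] [Module ℝ V] (d : ℕ) where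
  form : V →ₗ[ℝ] V →ₗ[ℝ] ℝ
  op : V →ₗ[ℝ] V →ₗ[ℝ] Module.End ℝ V
  form_comm : ∀ a b, form a b = form b a
  form_nondegenerate : ∀ a, (∀ b, form a b = 0) → a = 0
  op_comm : ∀ a b, op a b = op b a
  form_op_swap : ∀ a b x y, form (op a b x) y = form (op x y a) b
  op_cyclic : ∀ a b c, op a b c + op b c a + op c a b =
    (2 : ℝ) • (form a b • c + form b c • a + form c a • b)
  two_smul_op_op : ∀ v x, (2 : ℝ) • op v (op x x v) = op x x * op v v + op v v * op x x
  trace_op : ∀ a b, LinearMap.trace ℝ V (op a b) = 2 * d * form a b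

namespace LineSystem

variable {V : Type*} [AddCommGroup V] [Module ℝ V] {d : ℕ} (L : LineSystem V d)

theorem form_op_left (a b x y : V) : L.form (L.op a b x) y = L.form x (L.op a b y) := by
  rw [L.form_op_swap, L.op_comm x y, L.form_op_swap, L.form_comm]

theorem op_self_self (v : V) : L.op v v v = (2 * L.form v v) • v := by
  linear_combination (norm := module) (1 / 3 : ℝ) • L.op_cyclic v v v

theorem op_apply_left (v w : V) :
    L.op v w v = L.form v v • w + (2 * L.form v w) • v - (1 / 2 : ℝ) • L.op v v w := by
  have h := L.op_cyclic v w v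
  rw [L.op_comm w v, L.form_comm w v] at h
  linear_combination (norm := module) (1 / 2 : ℝ) • h

theorem op_self_mul_self (v : V) : L.op v v * L.op v v = (2 * L.form v v) • L.op v v := by
  have h := L.two_smul_op_op v v
  rw [L.op_self_self, map_smul] at h
  linear_combination (norm := module) (-1 / 2 : ℝ) • h

/-- The operators that behave with respect to `op v w` as a Hermitian matrix does with respect to
`v w* + w v*`; in the octonionic plane they include the Hermitian `2 × 2` matrices. -/
def hermitian : Submodule ℝ (Module.End ℝ V) where
  carrier := {A | (∀ v w, L.form (A v) w = L.form v (A w)) ∧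
    ∀ v w, L.op v (A w) + L.op w (A v) = A * L.op v w + L.op v w * A}
  zero_mem' := by simp
  add_mem' {A B} hA hB := by
    refine ⟨fun v w => ?_, fun v w => ?_⟩
    · simp only [LinearMap.add_apply, map_add, hA.1, hB.1]
    · simp only [LinearMap.add_apply, map_add, add_mul, mul_add]
      linear_combination (norm := module) hA.2 v w + hB.2 v w
  smul_mem' r A hA := by
    refine ⟨fun v w => ?_, fun v w => ?_⟩
    · simp only [LinearMap.smul_apply, map_smul, hA.1]
    · simp only [LinearMap.smul_apply, map_smul, smul_mul_assoc, mul_smul_comm]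
      linear_combination (norm := module) r • hA.2 v w

theorem one_mem_hermitian : 1 ∈ L.hermitian := by
  refine ⟨fun v w => rfl, fun v w => ?_⟩
  simp only [Module.End.one_apply, one_mul, mul_one, L.op_comm w v]

theorem op_self_mem_hermitian (x : V) : L.op x x ∈ L.hermitian := by
  refine ⟨L.form_op_left x x, fun v w => ?_⟩
  have h := L.two_smul_op_op (v + w) x
  simp only [map_add, LinearMap.add_apply, mul_add, add_mul, L.op_comm w v] at h
  linear_combination (norm := module)
    (1 / 2 : ℝ) • (h - L.two_smul_op_op v x - L.two_smul_op_op w x)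

theorem op_mem_hermitian (x y : V) : L.op x y ∈ L.hermitian := by
  have h : L.op x y = (1 / 2 : ℝ) • (L.op (x + y) (x + y) - L.op x x - L.op y y) := by
    simp only [map_add, LinearMap.add_apply, L.op_comm y x]
    module
  rw [h]
  exact L.hermitian.smul_mem _ (sub_mem (sub_mem (L.op_self_mem_hermitian _)
    (L.op_self_mem_hermitian x)) (L.op_self_mem_hermitian y))

section Hermitian

variable {L} {A B : Module.End ℝ V}

theorem form_hermitian_left (hA : A ∈ L.hermitian) (v w : V) :
    L.form (A v) w = L.form v (A w) :=
  hA.1 v w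

theorem op_hermitian_add_op_hermitian (hA : A ∈ L.hermitian) (v w : V) :
    L.op v (A w) + L.op w (A v) = A * L.op v w + L.op v w * A :=
  hA.2 v w

theorem two_smul_op_hermitian (hA : A ∈ L.hermitian) (v : V) :
    (2 : ℝ) • L.op v (A v) = A * L.op v v + L.op v v * A := by
  rw [two_smul, op_hermitian_add_op_hermitian hA]

theorem mul_op_self_add_mem_hermitian (hA : A ∈ L.hermitian) (v : V) :
    A * L.op v v + L.op v v * A ∈ L.hermitian := by
  rw [← two_smul_op_hermitian hA]
  exact L.hermitian.smul_mem _ (L.op_mem_hermitian _ _)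

theorem op_self_hermitian_apply (hA : A ∈ L.hermitian) (v : V) :
    L.op v v (A v) = (2 * L.form (A v) v) • v := by
  have h := LinearMap.congr_fun (two_smul_op_hermitian hA v) v
  simp only [LinearMap.smul_apply, LinearMap.add_apply, Module.End.mul_apply, L.op_self_self,
    L.op_apply_left v (A v), L.form_comm v (A v), map_smul] at h
  linear_combination (norm := module) (-1 / 2 : ℝ) • h

theorem two_smul_op_hermitian_apply_add (hA : A ∈ L.hermitian) (v w : V) :
    (2 : ℝ) • L.op v w (A v) + L.op v v (A w) =
      (2 * L.form (A v) v) • w + (4 * L.form (A v) w) • v := by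
  have hp := op_self_hermitian_apply hA (v + w)
  have hm := op_self_hermitian_apply hA (v - w)
  have hw := op_self_hermitian_apply hA w
  have hvw : L.form (A w) v = L.form (A v) w := by rw [form_hermitian_left hA, L.form_comm]
  simp only [map_add, map_sub, LinearMap.add_apply, LinearMap.sub_apply, L.op_comm w v, hvw]
    at hp hm
  linear_combination (norm := module) (1 / 2 : ℝ) • hp - (1 / 2 : ℝ) • hm - hw

theorem two_smul_op_hermitian_hermitian (hA : A ∈ L.hermitian) (hB : B ∈ L.hermitian)
    (hAB : A * B + B * A ∈ L.hermitian) (w : V) :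
    (2 : ℝ) • L.op (A w) (B w) = A * L.op w w * B + B * L.op w w * A := by
  have h₁ := op_hermitian_add_op_hermitian hA (B w) w
  have h₂ := op_hermitian_add_op_hermitian hB (A w) w
  have h₃ := two_smul_op_hermitian hAB w
  have hA' := two_smul_op_hermitian hA w
  have hB' := two_smul_op_hermitian hB w
  rw [L.op_comm (B w) (A w), L.op_comm (B w) w] at h₁
  rw [L.op_comm (A w) w] at h₂
  simp only [LinearMap.add_apply, Module.End.mul_apply, map_add] at h₃
  have h₁' : A * ((2 : ℝ) • L.op w (B w)) + ((2 : ℝ) • L.op w (B w)) * A =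
      (2 : ℝ) • (L.op (A w) (B w) + L.op w (A (B w))) := by
    rw [h₁, smul_add, mul_smul_comm, smul_mul_assoc]
  have h₂' : B * ((2 : ℝ) • L.op w (A w)) + ((2 : ℝ) • L.op w (A w)) * B =
      (2 : ℝ) • (L.op (A w) (B w) + L.op w (B (A w))) := by
    rw [h₂, smul_add, mul_smul_comm, smul_mul_assoc]
  rw [hB'] at h₁'
  rw [hA'] at h₂'
  simp only [mul_add, add_mul, ← mul_assoc] at h₁' h₂' h₃ ⊢
  linear_combination (norm := module) (-1 / 2 : ℝ) • (h₁' + h₂' + h₃)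

theorem two_smul_op_hermitian_mul (hA : A ∈ L.hermitian) (hB : B ∈ L.hermitian)
    (hAB : A * B + B * A ∈ L.hermitian) (v : V) :
    (2 : ℝ) • L.op v (A (B v)) = A * B * L.op v v + L.op v v * B * A := by
  have h := op_hermitian_add_op_hermitian hA (B v) v
  have hv := two_smul_op_hermitian_hermitian hA hB hAB v
  have hB' := two_smul_op_hermitian hB v
  rw [L.op_comm (B v) (A v), L.op_comm (B v) v] at h
  have h' : A * ((2 : ℝ) • L.op v (B v)) + ((2 : ℝ) • L.op v (B v)) * A =
      (2 : ℝ) • (L.op (A v) (B v) + L.op v (A (B v))) := by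
    rw [h, smul_add, mul_smul_comm, smul_mul_assoc]
  rw [hB'] at h'
  simp only [mul_add, add_mul, ← mul_assoc] at h' ⊢
  linear_combination (norm := module) -h' - hv

variable {S : Module.End ℝ V}

theorem op_hermitian (hS : S ∈ L.hermitian) (hSS : S * S ∈ L.hermitian) (v w : V) :
    L.op (S v) (S w) = S * L.op v w * S := by
  have hself (u : V) : L.op (S u) (S u) = S * L.op u u * S := by
    linear_combination (norm := module)
      (1 / 2 : ℝ) • two_smul_op_hermitian_hermitian hS hS (add_mem hSS hSS) u
  have h := hself (v + w)
  simp only [map_add, LinearMap.add_apply, mul_add, add_mul, L.op_comm (S w) (S v),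
    L.op_comm w v] at h
  linear_combination (norm := module) (1 / 2 : ℝ) • (h - hself v - hself w)

theorem op_cyclic_hermitian (hS : S ∈ L.hermitian) (a b c : V) :
    L.op a b (S c) + L.op b c (S a) + L.op c a (S b) =
      (2 : ℝ) • (L.form (S a) b • c + L.form (S b) c • a + L.form (S c) a • b) := by
  have h (x y z : V) := LinearMap.congr_fun (op_hermitian_add_op_hermitian hS x y) z
  simp only [LinearMap.add_apply, Module.End.mul_apply] at h
  have hsum := congrArg S (L.op_cyclic a b c)
  simp only [map_add, map_smul] at hsum
  have comm (x y : V) : L.form x (S y) = L.form (S y) x := L.form_comm _ _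
  have symm (x y : V) : L.form (S y) x = L.form (S x) y := by
    rw [form_hermitian_left hS, L.form_comm]
  have h₁ := L.op_cyclic a b (S c)
  have h₂ := L.op_cyclic b c (S a)
  have h₃ := L.op_cyclic c a (S b)
  rw [L.op_comm (S c) a, comm b c, symm b c] at h₁
  rw [L.op_comm (S a) b, comm c a, symm c a] at h₂
  rw [L.op_comm (S b) c, comm a b, symm a b] at h₃
  linear_combination (norm := module)
    (1 / 2 : ℝ) • (h₁ + h₂ + h₃ - hsum - h a b c - h b c a - h c a b)

/-- The line system whose form is `form` twisted by `S`, like the isotope of a Jordan algebra. -/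
def isotope (hS : S ∈ L.hermitian) (hSS : S * S ∈ L.hermitian) (hinj : Function.Injective S) :
    LineSystem V d where
  form := L.form.comp S
  op := L.op.compr₂ (LinearMap.mulRight ℝ S)
  form_comm a b := by
    rw [LinearMap.comp_apply, LinearMap.comp_apply, form_hermitian_left hS, L.form_comm]
  form_nondegenerate a ha :=
    hinj ((L.form_nondegenerate _ ha).trans (map_zero S).symm)
  op_comm a b := by simp only [LinearMap.compr₂_apply, L.op_comm a b]
  form_op_swap a b x y := by
    simp only [LinearMap.comp_apply, LinearMap.compr₂_apply, LinearMap.mulRight_apply,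
      Module.End.mul_apply]
    rw [form_hermitian_left hS, L.form_op_swap, op_hermitian hS hSS]
    rfl
  op_cyclic := op_cyclic_hermitian hS
  two_smul_op_op v x := by
    simp only [LinearMap.compr₂_apply, LinearMap.mulRight_apply, Module.End.mul_apply]
    have hX := mul_op_self_add_mem_hermitian hS x
    rw [add_comm] at hX
    rw [← smul_mul_assoc, two_smul_op_hermitian_mul (L.op_self_mem_hermitian x) hS hX]
    simp only [add_mul, mul_assoc]
  trace_op a b := by
    have h := congrArg (LinearMap.trace ℝ V) (op_hermitian_add_op_hermitian hS a b)
    rw [map_add, map_add, L.trace_op, L.trace_op, LinearMap.trace_mul_comm ℝ S,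
      L.form_comm b, ← form_hermitian_left hS] at h
    simp only [LinearMap.compr₂_apply, LinearMap.mulRight_apply, LinearMap.comp_apply]
    linarith

end Hermitian

end LineSystem

section Quadratic

variable {K W : Type*} [Field K] [AddCommGroup W] [Module K W] {f : Module.End K W} {a b : K}

theorem iSup_eigenspace_eq_top_of_apply_apply (hab : a ≠ b)
    (hf : ∀ y, f (f y) = (a + b) • f y - (a * b) • y) : ⨆ c, f.eigenspace c = ⊤ := by
  refine eq_top_iff.2 fun y _ => ?_
  have hsub : a - b ≠ 0 := sub_ne_zero.2 hab
  have hy : y = (a - b)⁻¹ • (f y - b • y) - (a - b)⁻¹ • (f y - a • y) := by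
    match_scalars <;> field_simp <;> ring
  have hmem (c c' : K) (h : f (f y) = (c + c') • f y - (c * c') • y) :
      f y - c' • y ∈ ⨆ c, f.eigenspace c := by
    refine Submodule.mem_iSup_of_mem c (Module.End.mem_eigenspace_iff.2 ?_)
    rw [map_sub, map_smul, h]
    module
  rw [hy]
  exact sub_mem (Submodule.smul_mem _ _ (hmem a b (hf y)))
    (Submodule.smul_mem _ _ (hmem b a (by rw [hf, add_comm, mul_comm])))

theorem eq_or_eq_of_hasEigenvalue_of_apply_apply
    (hf : ∀ y, f (f y) = (a + b) • f y - (a * b) • y) {c : K} (hc : f.HasEigenvalue c) :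
    c = a ∨ c = b := by
  obtain ⟨y, hy⟩ := hc.exists_hasEigenvector
  have h := hf y
  rw [hy.apply_eq_smul, map_smul, hy.apply_eq_smul] at h
  have hprod : ((c - a) * (c - b)) • y = 0 := by
    linear_combination (norm := module) h
  rcases mul_eq_zero.1 ((smul_eq_zero.1 hprod).resolve_right hy.2) with h | h
  · exact Or.inl (sub_eq_zero.1 h)
  · exact Or.inr (sub_eq_zero.1 h)

theorem hasEigenvalue_restrict_of_le {p q : Submodule K W} (hfp : ∀ y ∈ p, f y ∈ p) {c : K}
    (hq : q ≤ f.eigenspace c) (hqp : q ≤ p) (hne : q ≠ ⊥) :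
    Module.End.HasEigenvalue (f.restrict hfp) c := by
  obtain ⟨y, hy, hy₀⟩ := Submodule.exists_mem_ne_zero_of_ne_bot hne
  refine Module.End.hasEigenvalue_of_hasEigenvector (x := ⟨y, hqp hy⟩) ⟨?_, ?_⟩
  · exact Module.End.mem_eigenspace_iff.2 (Subtype.ext (Module.End.mem_eigenspace_iff.1 (hq hy)))
  · exact fun h => hy₀ (congrArg Subtype.val h)

end Quadratic

namespace LineSystem

variable {V : Type*} [AddCommGroup V] [Module ℝ V] {d : ℕ} (L : LineSystem V d) (k : ℝ)

theorem form_op_self (v y : V) :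
    L.form v (L.op v v y) = 2 * L.form v v * L.form v y := by
  rw [← L.form_op_left, L.op_self_self, map_smul, LinearMap.smul_apply, smul_eq_mul]

/-- The line through `v`, which has dimension `d` when `|v|² ≠ 0`. It is encoded as the range of
`op v v`, and so is not meaningful for `|v|² = 0`. -/
def line (v : V) : Submodule ℝ V := LinearMap.range (L.op v v)

section Line

variable {L} {v w : V}

theorem mem_line_iff (hv : L.form v v ≠ 0) {y : V} :
    y ∈ L.line v ↔ L.op v v y = (2 * L.form v v) • y := by
  constructor
  · rintro ⟨z, rfl⟩
    exact LinearMap.congr_fun (L.op_self_mul_self v) z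
  · intro h
    refine ⟨(2 * L.form v v)⁻¹ • y, ?_⟩
    rw [map_smul, h, inv_smul_smul₀ (mul_ne_zero two_ne_zero hv)]

theorem self_mem_line (hv : L.form v v ≠ 0) : v ∈ L.line v :=
  (mem_line_iff hv).2 (L.op_self_self v)

theorem ker_op_self_le_ker_form (hv : L.form v v ≠ 0) :
    LinearMap.ker (L.op v v) ≤ LinearMap.ker (L.form v) := by
  intro y hy
  have h := L.form_op_self v y
  rw [LinearMap.mem_ker.1 hy, map_zero] at h
  exact (mul_eq_zero.1 h.symm).resolve_left (mul_ne_zero two_ne_zero hv)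

theorem span_sup_line_inf_ker_form (hv : L.form v v ≠ 0) :
    Submodule.span ℝ {v} ⊔ (L.line v ⊓ LinearMap.ker (L.form v)) = L.line v := by
  have hle : Submodule.span ℝ {v} ≤ L.line v :=
    (Submodule.span_singleton_le_iff_mem _ _).2 (self_mem_line hv)
  rw [inf_comm, ← sup_inf_assoc_of_le _ hle, (L.form v).span_singleton_sup_ker_eq_top hv,
    top_inf_eq]

theorem op_self_apply_eq_zero_symm (hv : L.form v v ≠ 0) (h : L.op v v w = 0) :
    L.op w w v = 0 := by
  have hvw := LinearMap.congr_fun (L.two_smul_op_op w v) v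
  have hform : L.form (L.op w w v) v = 0 := by
    rw [L.form_op_swap, h, map_zero, LinearMap.zero_apply]
  simp only [h, map_zero, smul_zero, LinearMap.zero_apply, LinearMap.add_apply,
    Module.End.mul_apply, L.op_self_self, map_smul,
    op_self_hermitian_apply (L.op_self_mem_hermitian w) v, hform, mul_zero, zero_smul,
    zero_add] at hvw
  exact (smul_eq_zero.1 hvw.symm).resolve_left (mul_ne_zero two_ne_zero hv)

variable [FiniteDimensional ℝ V]

theorem finrank_line (hv : L.form v v ≠ 0) : Module.finrank ℝ (L.line v) = d := by
  have hproj : LinearMap.IsProj (L.line v) ((2 * L.form v v)⁻¹ • L.op v v) := by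
    refine ⟨fun y => Submodule.smul_mem _ _ ⟨y, rfl⟩, fun y hy => ?_⟩
    rw [LinearMap.smul_apply, (mem_line_iff hv).1 hy,
      inv_smul_smul₀ (mul_ne_zero two_ne_zero hv)]
  have htrace := hproj.trace
  rw [map_smul, L.trace_op, smul_eq_mul, mul_right_comm, inv_mul_cancel_left₀
    (mul_ne_zero two_ne_zero hv)] at htrace
  exact_mod_cast htrace.symm

theorem finrank_ker_op_self (hv : L.form v v ≠ 0) :
    Module.finrank ℝ (LinearMap.ker (L.op v v)) = Module.finrank ℝ V - d := by
  have h := LinearMap.finrank_range_add_finrank_ker (L.op v v)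
  have hline := finrank_line hv
  rw [line] at hline
  omega

theorem finrank_line_inf_ker_form (hv : L.form v v ≠ 0) :
    Module.finrank ℝ ↥(L.line v ⊓ LinearMap.ker (L.form v)) = d - 1 := by
  have hv₀ : v ≠ 0 := fun h => hv (by rw [h, map_zero])
  have hdisj : Submodule.span ℝ {v} ⊓ (L.line v ⊓ LinearMap.ker (L.form v)) = ⊥ :=
    ((Submodule.disjoint_span_singleton' hv₀).2 fun h => hv (Submodule.mem_inf.1 h).2).symm.eq_bot
  have h := Submodule.finrank_sup_add_finrank_inf_eq (Submodule.span ℝ {v})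
    (L.line v ⊓ LinearMap.ker (L.form v))
  rw [span_sup_line_inf_ker_form hv, hdisj, finrank_bot, finrank_span_singleton hv₀,
    finrank_line hv] at h
  omega

theorem line_eq_of_mem (hv : L.form v v ≠ 0) (hw : L.form w w ≠ 0) (h : w ∈ L.line v) :
    L.line v = L.line w := by
  refine (Submodule.eq_of_le_of_finrank_eq ?_ ((finrank_line hw).trans (finrank_line hv).symm)).symm
  have hop : L.op v v * L.op w w * L.op v v =
      ((2 * L.form v v) * (2 * L.form v v)) • L.op w w := by
    have hVV : L.op v v * L.op v v ∈ L.hermitian := by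
      rw [L.op_self_mul_self]
      exact L.hermitian.smul_mem _ (L.op_self_mem_hermitian v)
    rw [← op_hermitian (L.op_self_mem_hermitian v) hVV, (mem_line_iff hv).1 h, map_smul, map_smul,
      LinearMap.smul_apply, smul_smul]
  rintro _ ⟨y, rfl⟩
  have hne : (2 * L.form v v) * (2 * L.form v v) ≠ 0 := by positivity
  rw [← inv_smul_smul₀ hne (L.op w w y), ← LinearMap.smul_apply, ← hop]
  exact Submodule.smul_mem _ _ ⟨_, rfl⟩

end Line

/-- The Jacobi operator at the origin of the metric attached to `L` and the constant `k`: on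
`v^⊥` it is `4 k |v|²` on the line through `v` and `k |v|²` on the orthogonal complement. -/
def jacobiOp (v : V) : Module.End ℝ V :=
  k • (L.form v v • 1 + (3 / 2 : ℝ) • L.op v v - (4 : ℝ) • (L.form v).smulRight v)

theorem jacobiOp_apply (v y : V) : L.jacobiOp k v y =
    k • (L.form v v • y + (3 / 2 : ℝ) • L.op v v y - (4 * L.form v y) • v) := by
  simp [jacobiOp, smul_smul]

theorem form_jacobiOp (v y : V) : L.form v (L.jacobiOp k v y) = 0 := by
  simp only [jacobiOp_apply, map_smul, map_sub, map_add, form_op_self, smul_eq_mul]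
  ring

section JacobiOp

variable {L} {k} {v w : V}

theorem form_eq_zero_of_jacobiOp_eq_smul {c : ℝ} (hc : c ≠ 0) {y : V}
    (h : L.jacobiOp k v y = c • y) : L.form v y = 0 := by
  have h' := L.form_jacobiOp k v y
  rw [h, map_smul, smul_eq_mul] at h'
  exact (mul_eq_zero.1 h').resolve_left hc

theorem eigenspace_jacobiOp_four_mul (hk : k ≠ 0) (hv : L.form v v ≠ 0) :
    (L.jacobiOp k v).eigenspace (L.form v v * (4 * k)) = L.line v ⊓ LinearMap.ker (L.form v) := by
  ext y
  rw [Module.End.mem_eigenspace_iff, Submodule.mem_inf, mem_line_iff hv, LinearMap.mem_ker]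
  constructor
  · intro h
    have hy := form_eq_zero_of_jacobiOp_eq_smul (by positivity) h
    rw [jacobiOp_apply, hy] at h
    have hdiff : (3 / 2 * k) • (L.op v v y - (2 * L.form v v) • y) = 0 := by
      linear_combination (norm := module) h
    exact ⟨sub_eq_zero.1 ((smul_eq_zero.1 hdiff).resolve_left (by positivity)), hy⟩
  · rintro ⟨h, hy⟩
    rw [jacobiOp_apply, h, hy]
    module

theorem eigenspace_jacobiOp (hk : k ≠ 0) (hv : L.form v v ≠ 0) :
    (L.jacobiOp k v).eigenspace (L.form v v * k) = LinearMap.ker (L.op v v) := by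
  ext y
  rw [Module.End.mem_eigenspace_iff, LinearMap.mem_ker]
  constructor
  · intro h
    have hy := form_eq_zero_of_jacobiOp_eq_smul (by positivity) h
    rw [jacobiOp_apply, hy] at h
    have hop : (3 / 2 * k) • L.op v v y = 0 := by
      linear_combination (norm := module) h
    exact (smul_eq_zero.1 hop).resolve_left (by positivity)
  · intro h
    have hy : L.form v y = 0 := ker_op_self_le_ker_form hv h
    rw [jacobiOp_apply, h, hy]
    module

theorem jacobiOp_jacobiOp {y : V} (hy : L.form v y = 0) : L.jacobiOp k v (L.jacobiOp k v y) =
    (L.form v v * (4 * k) + L.form v v * k) • L.jacobiOp k v y -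
      (L.form v v * (4 * k) * (L.form v v * k)) • y := by
  have hVV := LinearMap.congr_fun (L.op_self_mul_self v) y
  rw [Module.End.mul_apply, LinearMap.smul_apply] at hVV
  rw [jacobiOp_apply L k v (L.jacobiOp k v y), form_jacobiOp, jacobiOp_apply, hy]
  simp only [map_smul, map_add, hVV, mul_zero, zero_smul, sub_zero]
  module

theorem span_sup_eigenspace_jacobiOp (hk : k ≠ 0) (hv : L.form v v ≠ 0) :
    Submodule.span ℝ {v} ⊔ (L.jacobiOp k v).eigenspace (L.form v v * (4 * k)) = L.line v := by
  rw [eigenspace_jacobiOp_four_mul hk hv, span_sup_line_inf_ker_form hv]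

theorem mem_eigenspace_jacobiOp_symm (hk : k ≠ 0) (hv : L.form v v ≠ 0)
    (h : w ∈ (L.jacobiOp k v).eigenspace (L.form v v * k)) :
    v ∈ (L.jacobiOp k w).eigenspace (L.form w w * k) := by
  rw [eigenspace_jacobiOp hk hv] at h
  have hform : L.form w v = 0 := (L.form_comm w v).trans (ker_op_self_le_ker_form hv h)
  rw [Module.End.mem_eigenspace_iff, jacobiOp_apply, op_self_apply_eq_zero_symm hv h, hform]
  module

variable [FiniteDimensional ℝ V]

theorem finrank_eigenspace_jacobiOp_four_mul (hk : k ≠ 0) (hv : L.form v v ≠ 0) :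
    Module.finrank ℝ ↥((L.jacobiOp k v).eigenspace (L.form v v * (4 * k)) ⊓
      LinearMap.ker (L.form v)) = d - 1 := by
  rw [eigenspace_jacobiOp_four_mul hk hv, inf_assoc, inf_idem, finrank_line_inf_ker_form hv]

theorem finrank_eigenspace_jacobiOp (hk : k ≠ 0) (hv : L.form v v ≠ 0) :
    Module.finrank ℝ ↥((L.jacobiOp k v).eigenspace (L.form v v * k) ⊓
      LinearMap.ker (L.form v)) = Module.finrank ℝ V - d := by
  rw [eigenspace_jacobiOp hk hv, inf_of_le_left (ker_op_self_le_ker_form hv),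
    finrank_ker_op_self hv]

theorem jacobiOp_restrict_diagonalizable (hk : k ≠ 0) (hd : 2 ≤ d) (hdV : d < Module.finrank ℝ V)
    (hv : L.form v v ≠ 0) :
    ∃ h : ∀ y ∈ LinearMap.ker (L.form v), L.jacobiOp k v y ∈ LinearMap.ker (L.form v),
      (⨆ c : ℝ, Module.End.eigenspace ((L.jacobiOp k v).restrict h) c) = ⊤ ∧
      ∀ c : ℝ, Module.End.HasEigenvalue ((L.jacobiOp k v).restrict h) c ↔
        c = L.form v v * (4 * k) ∨ c = L.form v v * k := by
  have maps (y : V) (_ : y ∈ LinearMap.ker (L.form v)) :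
      L.jacobiOp k v y ∈ LinearMap.ker (L.form v) := L.form_jacobiOp k v y
  have hquad (y : LinearMap.ker (L.form v)) :
      (L.jacobiOp k v).restrict maps ((L.jacobiOp k v).restrict maps y) =
        (L.form v v * (4 * k) + L.form v v * k) • (L.jacobiOp k v).restrict maps y -
          (L.form v v * (4 * k) * (L.form v v * k)) • y :=
    Subtype.ext (jacobiOp_jacobiOp y.2)
  have hne : L.form v v * (4 * k) ≠ L.form v v * k := fun h => by
    have : L.form v v * k ≠ 0 := mul_ne_zero hv hk
    exact this (by linarith)
  have hasEigenvalue (c : ℝ) (hc : 0 < Module.finrank ℝ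
      ↥((L.jacobiOp k v).eigenspace c ⊓ LinearMap.ker (L.form v))) :
      Module.End.HasEigenvalue ((L.jacobiOp k v).restrict maps) c :=
    hasEigenvalue_restrict_of_le maps inf_le_left inf_le_right
      fun h => by rw [h, finrank_bot] at hc; exact lt_irrefl _ hc
  refine ⟨maps, iSup_eigenspace_eq_top_of_apply_apply hne hquad, fun c =>
    ⟨eq_or_eq_of_hasEigenvalue_of_apply_apply hquad, ?_⟩⟩
  rintro (rfl | rfl)
  · exact hasEigenvalue _ (by rw [finrank_eigenspace_jacobiOp_four_mul hk hv]; omega)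
  · exact hasEigenvalue _ (by rw [finrank_eigenspace_jacobiOp hk hv]; omega)

end JacobiOp

end LineSystem

/-! ### The metric of a line system -/

namespace LineSystem

section Metric

variable {V : Type*} [AddCommGroup V] [Module ℝ V] {d : ℕ} (L : LineSystem V d) (k : ℝ)

/-- The factor `1 + k |x|²`, whose square is the denominator of the metric. -/
def denom (x : V) : ℝ := 1 + k * L.form x x

/-- The operator representing the metric at `x` with respect to `form`. -/
def metricOp (x : V) : Module.End ℝ V :=
  (L.denom k x)⁻¹ • 1 - (k / 2 * (L.denom k x)⁻¹ ^ 2) • L.op x x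

theorem metricOp_apply (x v : V) : L.metricOp k x v =
    (L.denom k x)⁻¹ • v - (k / 2 * (L.denom k x)⁻¹ ^ 2) • L.op x x v := rfl

theorem metricOp_mem_hermitian (x : V) : L.metricOp k x ∈ L.hermitian :=
  sub_mem (L.hermitian.smul_mem _ L.one_mem_hermitian)
    (L.hermitian.smul_mem _ (L.op_self_mem_hermitian x))

theorem metricOp_mul_self_mem_hermitian (x : V) :
    L.metricOp k x * L.metricOp k x ∈ L.hermitian := by
  simp only [metricOp, mul_sub, sub_mul, smul_mul_smul_comm, one_mul, mul_one,
    L.op_self_mul_self]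
  have h₁ (r : ℝ) : r • (1 : Module.End ℝ V) ∈ L.hermitian :=
    L.hermitian.smul_mem _ L.one_mem_hermitian
  have hop (r : ℝ) : r • L.op x x ∈ L.hermitian :=
    L.hermitian.smul_mem _ (L.op_self_mem_hermitian x)
  exact sub_mem (sub_mem (h₁ _) (hop _)) (sub_mem (hop _) (L.hermitian.smul_mem _ (hop _)))

variable {L k} {x : V}

theorem metricOp_injective (hx : L.denom k x ≠ 0) : Function.Injective (L.metricOp k x) := by
  refine (injective_iff_map_eq_zero _).2 fun v hv => ?_
  have hN : L.denom k x • v = (k / 2) • L.op x x v := by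
    rw [metricOp_apply, sub_eq_zero] at hv
    have h := congrArg ((L.denom k x) ^ 2 • ·) hv
    simp only [smul_smul] at h
    field_simp at h
    exact h
  have hop : L.op x x v = 0 := by
    have h := congrArg (L.op x x) hN
    rw [map_smul, map_smul, ← Module.End.mul_apply, L.op_self_mul_self, LinearMap.smul_apply,
      denom] at h
    linear_combination (norm := module) h
  rw [hop, smul_zero] at hN
  exact (smul_eq_zero.1 hN).resolve_left hx

/-- The line system of the tangent space at `x`: its form is the metric at `x`. -/
def tangent (hx : L.denom k x ≠ 0) : LineSystem V d :=
  isotope (L.metricOp_mem_hermitian k x) (L.metricOp_mul_self_mem_hermitian k x)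
    (metricOp_injective hx)

theorem tangent_form_apply (hx : L.denom k x ≠ 0) (v w : V) :
    (tangent hx).form v w = L.form (L.metricOp k x v) w := rfl

theorem tangent_op_apply (hx : L.denom k x ≠ 0) (v w y : V) :
    (tangent hx).op v w y = L.op v w (L.metricOp k x y) := rfl

end Metric

section Triple

variable {V : Type*} [AddCommGroup V] [Module ℝ V] {d : ℕ} (L : LineSystem V d)

/-- The triple product `{a x b}` of the associated Jordan triple system, linear in `x`, `a`, `b`
in this order; up to the factor `-k / denom k x` it is the Christoffel symbol at `x`. -/
def triple : V →ₗ[ℝ] V →ₗ[ℝ] V →ₗ[ℝ] V :=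
  LinearMap.mk₂ ℝ
    (fun x a => (2 * L.form a x) • LinearMap.id + (2 : ℝ) • (L.form x).smulRight a -
      (L.op a).flip x)
    (fun x y a => by ext b; simp; module) (fun r x a => by ext b; simp; module)
    (fun x a b => by ext c; simp; module) (fun r x a => by ext b; simp; module)

theorem triple_apply (x a b : V) : L.triple x a b =
    (2 * L.form x a) • b + (2 * L.form x b) • a - L.op a b x := by
  simp [triple, smul_smul, L.form_comm a x]

theorem triple_sub_triple (v y : V) : L.triple v y v - L.triple y v v =
    L.form v v • y + (3 / 2 : ℝ) • L.op v v y - (4 * L.form v y) • v := by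
  simp only [triple_apply, L.op_comm y v, L.op_apply_left, L.form_comm y v]
  module

theorem op_self_op_apply (x a b : V) :
    L.op x x (L.op a b x) = (2 * L.form (L.op x x a) b) • x := by
  rw [op_self_hermitian_apply (L.op_mem_hermitian a b), L.form_op_swap]

variable (x : V)

/-- The part of the curvature that is quadratic in the Christoffel symbols. -/
theorem triple_triple_sub (v y : V) :
    (2 * L.form x y) • L.triple x v v - (2 * L.form x v) • L.triple x y v
        + L.triple x y (L.triple x v v) - L.triple x v (L.triple x y v) =
      (2 * L.form (L.op x x v) y) • v - (1 / 2 * L.form (L.op x x v) v) • y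
        - (3 / 4 : ℝ) • L.op v v (L.op x x y) := by
  have herm (a b c e z : V) := LinearMap.congr_fun
    (op_hermitian_add_op_hermitian (L.op_mem_hermitian a b) c e) z
  have polar (a b c e : V) := two_smul_op_hermitian_apply_add (L.op_mem_hermitian a b) c e
  have h₁ := herm v v y x x
  have h₂ := herm v y v x x
  have h₃ := polar v v x y
  have h₄ := polar v y x v
  have h₅ := polar x x v y
  have swap (a b : V) : L.form (L.op a b x) x = L.form (L.op x x a) b := L.form_op_swap a b x x
  have swap' (a b : V) : L.form x (L.op a b x) = L.form (L.op x x a) b :=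
    (L.form_comm _ _).trans (swap a b)
  have adj : L.form x (L.op v v y) = L.form (L.op v v x) y := (L.form_op_left v v x y).symm
  have form_op_x_v : L.form (L.op v y x) v = L.form v v * L.form x y + 2 * L.form v y * L.form x v
      - 1 / 2 * L.form (L.op v v x) y := by
    rw [L.form_op_left, L.op_apply_left]
    simp only [map_add, map_sub, map_smul, smul_eq_mul, adj]
  simp only [triple_apply, L.op_comm y v, L.op_comm y x, L.op_comm v x, map_add, map_sub, map_smul,
    LinearMap.add_apply, LinearMap.sub_apply, LinearMap.smul_apply, Module.End.mul_apply,
    L.op_apply_left, swap, swap', adj, form_op_x_v] at h₁ h₂ h₃ h₄ h₅ ⊢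
  linear_combination (norm := module) h₁ - h₂ + (1 / 2 : ℝ) • h₃ - (1 / 2 : ℝ) • h₄
    + (1 / 4 : ℝ) • h₅

variable {k : ℝ} {x : V}

theorem jacobiOp_tangent_apply (hx : L.denom k x ≠ 0) (v y : V) :
    (tangent hx).jacobiOp k v y =
      (k / L.denom k x) • (L.triple v y v - L.triple y v v) + (k ^ 2 / L.denom k x ^ 2) •
        ((2 * L.form x y) • L.triple x v v - (2 * L.form x v) • L.triple x y v
          + L.triple x y (L.triple x v v) - L.triple x v (L.triple x y v)) := by
  simp only [triple_sub_triple, triple_triple_sub, jacobiOp_apply, tangent_form_apply,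
    tangent_op_apply, metricOp_apply, map_sub, map_smul, LinearMap.sub_apply,
    LinearMap.smul_apply, smul_eq_mul]
  match_scalars <;> field_simp <;> ring

theorem form_metricOp_triple (hx : L.denom k x ≠ 0) (a b c : V) :
    L.form (L.metricOp k x (-(k / L.denom k x) • L.triple x a b)) c =
      -(k / L.denom k x ^ 2) *
          (L.form x a * L.form b c + L.form x b * L.form a c - L.form x c * L.form a b)
        - k / 2 / L.denom k x ^ 2 *
          (L.form (L.op x a b) c + L.form (L.op x b a) c - L.form (L.op x c a) b)
        + k ^ 2 / L.denom k x ^ 3 * (L.form x a * L.form (L.op x x b) c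
          + L.form x b * L.form (L.op x x a) c - L.form x c * L.form (L.op x x a) b) := by
  have cyclic := congrArg (L.form · c) (L.op_cyclic x a b)
  simp only [metricOp_apply, triple_apply, map_add, map_sub, map_smul, LinearMap.add_apply,
    LinearMap.sub_apply, LinearMap.smul_apply, smul_eq_mul, op_self_op_apply, L.form_op_swap x c,
    L.form_comm b x, L.op_comm b x] at cyclic ⊢
  field_simp
  linear_combination L.denom k x * k * cyclic

end Triple

end LineSystem

section Calculus

variable {V W : Type*} [NormedAddCommGroup V] [NormedSpace ℝ V]
  [NormedAddCommGroup W] [NormedSpace ℝ W]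

theorem hasFDerivAt_diag {β : V →L[ℝ] V →L[ℝ] W} (hβ : ∀ x y, β x y = β y x) (x : V) :
    HasFDerivAt (fun y => β y y) ((2 : ℝ) • β x) x := by
  refine (β.hasFDerivAt_of_bilinear (hasFDerivAt_id x) (hasFDerivAt_id x)).congr_fderiv ?_
  ext u
  simp [hβ u x, two_smul]

theorem contDiff_diag (β : V →L[ℝ] V →L[ℝ] W) {n : WithTop ℕ∞} : ContDiff ℝ n fun y => β y y :=
  β.isBoundedBilinearMap.contDiff.comp (contDiff_id.prodMk contDiff_id)

variable [FiniteDimensional ℝ V]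

/-- `LinearMap.toContinuousBilinearMap` as a linear map. -/
def toContinuousBilinearMapₗ : (V →ₗ[ℝ] V →ₗ[ℝ] W) →ₗ[ℝ] V →L[ℝ] V →L[ℝ] W where
  toFun := LinearMap.toContinuousBilinearMap
  map_add' _ _ := rfl
  map_smul' _ _ := rfl

theorem inverse_apply_of_nondegenerate {g : V →L[ℝ] V →L[ℝ] ℝ}
    (hg : ∀ v, (∀ w, g v w = 0) → v = 0) (z : V) : g.inverse (g z) = z := by
  have hker : LinearMap.ker (g : V →ₗ[ℝ] V →L[ℝ] ℝ) = ⊥ :=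
    LinearMap.ker_eq_bot'.2 fun v hv => hg v fun w => congrArg (· w) hv
  have hdim : Module.finrank ℝ V = Module.finrank ℝ (V →L[ℝ] ℝ) := by
    rw [← (LinearMap.toContinuousLinearMap (𝕜 := ℝ) (E := V) (F' := ℝ)).finrank_eq]
    exact Subspace.dual_finrank_eq.symm
  let e := (LinearEquiv.ofInjectiveOfFinrankEq _ (LinearMap.ker_eq_bot.1 hker) hdim)
    |>.toContinuousLinearEquiv
  change (e : V →L[ℝ] V →L[ℝ] ℝ).inverse (e z) = z
  rw [ContinuousLinearMap.inverse_equiv]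
  exact e.symm_apply_apply z

end Calculus

section JacobiLocal

open Filter Topology

variable {V : Type*} [NormedAddCommGroup V] [NormedSpace ℝ V] {G G' : V → V →L[ℝ] V →L[ℝ] ℝ}
  {x : V}

theorem christoffel_congr (h : G =ᶠ[𝓝 x] G') : christoffel G x = christoffel G' x := by
  rw [christoffel, christoffel, christoffelLower, christoffelLower, h.fderiv_eq, h.eq_of_nhds]

theorem jacobiLocal_congr (h : G =ᶠ[𝓝 x] G') (v : V) :
    jacobiLocal G x v = jacobiLocal G' x v := by
  have hΓ : christoffel G =ᶠ[𝓝 x] christoffel G' :=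
    h.eventually_nhds.mono fun _ hy => christoffel_congr hy
  ext y
  change curvature G x v y v = curvature G' x v y v
  simp only [curvature, hΓ.fderiv_eq, hΓ.eq_of_nhds]

end JacobiLocal

namespace LineSystem

open Filter Topology

variable {V : Type*} [NormedAddCommGroup V] [NormedSpace ℝ V] [FiniteDimensional ℝ V] {d : ℕ}
  (L : LineSystem V d) (k : ℝ) {x : V}

/-- The metric on `{x | denom k x ≠ 0}` whose value at `x` is the form of `tangent` at `x`. -/
def metric (x : V) : V →L[ℝ] V →L[ℝ] ℝ :=
  (L.form ∘ₗ L.metricOp k x).toContinuousBilinearMap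

theorem metric_apply (x v w : V) : L.metric k x v w = L.form (L.metricOp k x v) w := rfl

/-- The forms `(v, w) ↦ form (op x y v) w`, as a continuous bilinear function of `x` and `y`. -/
def formOp : V →L[ℝ] V →L[ℝ] V →L[ℝ] V →L[ℝ] ℝ :=
  LinearMap.toContinuousBilinearMap <|
    L.op.compr₂ (toContinuousBilinearMapₗ ∘ₗ LinearMap.llcomp ℝ V V _ L.form)

theorem formOp_apply (x y v w : V) : L.formOp x y v w = L.form (L.op x y v) w := rfl

theorem formOp_comm (x y : V) : L.formOp x y = L.formOp y x := by
  ext v w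
  rw [formOp_apply, formOp_apply, L.op_comm]

theorem metric_eq_smul_sub : L.metric k = fun x =>
    (L.denom k x)⁻¹ • L.form.toContinuousBilinearMap
      - (k / 2 * (L.denom k x)⁻¹ ^ 2) • L.formOp x x := by
  ext x v w
  simp [metric_apply, metricOp_apply, formOp_apply]

theorem contDiff_denom {n : WithTop ℕ∞} : ContDiff ℝ n (L.denom k) :=
  contDiff_const.add (contDiff_const.mul (contDiff_diag L.form.toContinuousBilinearMap))

theorem contDiffAt_metric (hx : L.denom k x ≠ 0) {n : WithTop ℕ∞} :
    ContDiffAt ℝ n (L.metric k) x := by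
  have hN : ContDiffAt ℝ n (fun y => (L.denom k y)⁻¹) x := (L.contDiff_denom k).contDiffAt.inv hx
  rw [metric_eq_smul_sub]
  exact (hN.smul contDiffAt_const).sub
    ((contDiffAt_const.mul (hN.pow 2)).smul (contDiff_diag L.formOp).contDiffAt)

theorem hasFDerivAt_denom_inv (hx : L.denom k x ≠ 0) :
    HasFDerivAt (fun y => (L.denom k y)⁻¹)
      (-(2 * k / L.denom k x ^ 2) • L.form.toContinuousBilinearMap x) x := by
  have hN : HasFDerivAt (L.denom k) (k • (2 : ℝ) • L.form.toContinuousBilinearMap x) x :=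
    ((hasFDerivAt_diag (β := L.form.toContinuousBilinearMap) L.form_comm x).const_mul k).const_add 1
  refine ((hasDerivAt_inv hx).comp_hasFDerivAt x hN).congr_fderiv ?_
  module

theorem fderiv_metric_apply (hx : L.denom k x ≠ 0) (u v w : V) :
    fderiv ℝ (L.metric k) x u v w =
      -(2 * k * L.form x u * L.form v w + k * L.form (L.op x u v) w) / L.denom k x ^ 2
        + 2 * k ^ 2 * L.form x u * L.form (L.op x x v) w / L.denom k x ^ 3 := by
  have hN := L.hasFDerivAt_denom_inv k hx
  have hG := (hN.smul_const L.form.toContinuousBilinearMap).sub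
    (((hN.pow 2).const_mul (k / 2)).smul (hasFDerivAt_diag L.formOp_comm x))
  rw [metric_eq_smul_sub]
  refine (congrArg (fun T : V →L[ℝ] V →L[ℝ] V →L[ℝ] ℝ => T u v w) hG.fderiv).trans ?_
  simp only [neg_smul, inv_pow, Nat.add_one_sub_one, pow_one, nsmul_eq_mul, Nat.cast_ofNat,
    smul_neg, sub_apply, ContinuousLinearMap.smulRight_apply, neg_apply, smul_apply,
    LinearMap.toContinuousBilinearMap_apply, smul_eq_mul, add_apply, formOp_apply, neg_add_rev]
  field_simp
  ring

theorem christoffelLower_metric (hx : L.denom k x ≠ 0) (a b : V) :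
    christoffelLower (L.metric k) x a b =
      L.metric k x (-(k / L.denom k x) • L.triple x a b) := by
  ext c
  rw [christoffelLower_apply, metric_apply, form_metricOp_triple L hx]
  simp only [L.fderiv_metric_apply k hx]
  field_simp
  ring

theorem christoffel_metric (hx : L.denom k x ≠ 0) (a b : V) :
    christoffel (L.metric k) x a b = -(k / L.denom k x) • L.triple x a b := by
  rw [christoffel_apply, L.christoffelLower_metric k hx]
  exact inverse_apply_of_nondegenerate (tangent hx).form_nondegenerate _

theorem fderiv_christoffel_metric (hx : L.denom k x ≠ 0) (u a b : V) :
    fderiv ℝ (christoffel (L.metric k)) x u a b =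
      -(k / L.denom k x) • L.triple u a b
        + (2 * k ^ 2 * L.form x u / L.denom k x ^ 2) • L.triple x a b := by
  let tripleL : V →L[ℝ] V →L[ℝ] V →L[ℝ] V :=
    LinearMap.toContinuousLinearMap (toContinuousBilinearMapₗ ∘ₗ L.triple)
  have hN : HasFDerivAt (fun y => -k * (L.denom k y)⁻¹) _ x :=
    (L.hasFDerivAt_denom_inv k hx).const_mul (-k)
  have hΓ : christoffel (L.metric k) =ᶠ[𝓝 x] fun y => (-k * (L.denom k y)⁻¹) • tripleL y := by
    filter_upwards [(L.contDiff_denom k (n := 0)).continuous.continuousAt.eventually_ne hx]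
      with y hy
    ext a b
    rw [L.christoffel_metric k hy, div_eq_mul_inv, ← neg_mul]
    rfl
  rw [hΓ.fderiv_eq, (hN.fun_smul tripleL.hasFDerivAt).fderiv]
  change (-k * (L.denom k x)⁻¹) • L.triple u a b
    + (-k * (-(2 * k / L.denom k x ^ 2) * L.form x u)) • L.triple x a b = _
  module

theorem jacobiLocal_metric (hx : L.denom k x ≠ 0) (v : V) :
    jacobiLocal (L.metric k) x v = (tangent hx).jacobiOp k v := by
  ext y
  change curvature (L.metric k) x v y v = _
  simp only [curvature, L.fderiv_christoffel_metric k hx, L.christoffel_metric k hx, map_smul]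
  rw [jacobiOp_tangent_apply]
  module

end LineSystem

section Manifold

variable {E : Type*} [NormedAddCommGroup E] [NormedSpace ℝ E] {M : Type*} [TopologicalSpace M]
  [ChartedSpace E M]
  {g : ∀ p : M, TangentSpace 𝓘(ℝ, E) p →L[ℝ] TangentSpace 𝓘(ℝ, E) p →L[ℝ] ℝ} {d : ℕ} {k : ℝ}

theorem IsUnitVector.apply_self_ne_zero {p : M} {v : TangentSpace 𝓘(ℝ, E) p}
    (hv : IsUnitVector g p v) : g p v v ≠ 0 := by
  rcases hv with h | h <;> rw [h] <;> norm_num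

section LineSystem

variable {L : ∀ p : M, LineSystem (TangentSpace 𝓘(ℝ, E) p) d}

theorem perp_eq_ker_form (hg : ∀ p v w, g p v w = (L p).form v w) (p : M)
    (v : TangentSpace 𝓘(ℝ, E) p) : perp g p v = LinearMap.ker ((L p).form v) := by
  ext y
  exact Eq.congr_left (hg p v y)

theorem jacobiEigenspace_eq_eigenspace_jacobiOp (hg : ∀ p v w, g p v w = (L p).form v w)
    (hJ : ∀ p v, jacobi g p v = (L p).jacobiOp k v) (c : ℝ) (p : M)
    (v : TangentSpace 𝓘(ℝ, E) p) :
    jacobiEigenspace g c p v = ((L p).jacobiOp k v).eigenspace ((L p).form v v * c) := by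
  rw [jacobiEigenspace, hJ, hg]

variable [FiniteDimensional ℝ E]

theorem isSpecialOssermanWith_of_jacobi_eq (hs : IsSemiRiemannian g) (hk : k ≠ 0) (hd : 2 ≤ d)
    (hdE : d < Module.finrank ℝ E) (hg : ∀ p v w, g p v w = (L p).form v w)
    (hJ : ∀ p v, jacobi g p v = (L p).jacobiOp k v) :
    IsSpecialOssermanWith g (4 * k) k ∧ HasMultiplicity g (4 * k) (d - 1) ∧
      HasMultiplicity g k (Module.finrank ℝ E - d) := by
  have hfin (p : M) : FiniteDimensional ℝ (TangentSpace 𝓘(ℝ, E) p) :=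
    inferInstanceAs (FiniteDimensional ℝ E)
  have hunit {p : M} {v : TangentSpace 𝓘(ℝ, E) p} (hv : IsUnitVector g p v) :
      (L p).form v v ≠ 0 := hg p v v ▸ hv.apply_self_ne_zero
  have hline {p : M} {v : TangentSpace 𝓘(ℝ, E) p} (hv : IsUnitVector g p v) :
      extendedEigenspace g (4 * k) p v = (L p).line v := by
    rw [extendedEigenspace, jacobiEigenspace_eq_eigenspace_jacobiOp hg hJ,
      LineSystem.span_sup_eigenspace_jacobiOp hk (hunit hv)]
  refine ⟨{ isSemiRiemannian := hs, lam_ne_zero := mul_ne_zero four_ne_zero hk, mu_ne_zero := hk,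
            lam_ne_mu := fun h => hk (by linarith), condition_one := fun p v hv => ?_,
            condition_two := fun p v w hv hw h => ?_, condition_three := fun p v w hv h => ?_ },
    fun p v hv => ?_, fun p v hv => ?_⟩
  · obtain ⟨h, htop, heig⟩ := LineSystem.jacobiOp_restrict_diagonalizable hk hd hdE (hunit hv)
    rw [hJ, perp_eq_ker_form hg, hg]
    exact ⟨h, htop, fun c _ => heig c⟩
  · rw [hline hv] at h ⊢
    rw [hline hw]
    exact LineSystem.line_eq_of_mem (hunit hv) (hunit hw) h
  · rw [jacobiEigenspace_eq_eigenspace_jacobiOp hg hJ] at h ⊢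
    exact LineSystem.mem_eigenspace_jacobiOp_symm hk (hunit hv) h
  · rw [jacobiEigenspace_eq_eigenspace_jacobiOp hg hJ, perp_eq_ker_form hg]
    exact LineSystem.finrank_eigenspace_jacobiOp_four_mul hk (hunit hv)
  · rw [jacobiEigenspace_eq_eigenspace_jacobiOp hg hJ, perp_eq_ker_form hg]
    exact LineSystem.finrank_eigenspace_jacobiOp hk (hunit hv)

end LineSystem

variable [FiniteDimensional ℝ E]

theorem isSpecialOssermanWith_of_localMetric_eq (L : LineSystem E d) (hk : k ≠ 0) (hd : 2 ≤ d)
    (hdE : d < Module.finrank ℝ E)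
    (hg : ∀ (p : M) (v w : E), g p v w = L.metric k (chartAt E p p) v w)
    (hloc : ∀ e ∈ atlas E M, Set.EqOn (localMetric g e) (L.metric k) e.target)
    (hN : ∀ e ∈ atlas E M, ∀ x ∈ e.target, L.denom k x ≠ 0) :
    IsSpecialOssermanWith g (4 * k) k ∧ HasMultiplicity g (4 * k) (d - 1) ∧
      HasMultiplicity g k (Module.finrank ℝ E - d) := by
  have hx (p : M) : L.denom k (chartAt E p p) ≠ 0 :=
    hN _ (chart_mem_atlas E p) _ (mem_chart_target E p)
  have hJ (p : M) (v : E) :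
      jacobi g p v = (LineSystem.tangent (hx p)).jacobiOp k v := by
    have hev : localMetric g (chartAt E p) =ᶠ[nhds (chartAt E p p)] L.metric k :=
      (hloc _ (chart_mem_atlas E p)).eventuallyEq_of_mem
        ((chartAt E p).open_target.mem_nhds (mem_chart_target E p))
    exact (jacobiLocal_congr hev v).trans (L.jacobiLocal_metric k (hx p) v)
  have hs : IsSemiRiemannian g :=
    { symm := fun p v w => by
        refine (hg p v w).trans (Eq.trans ?_ (hg p w v).symm)
        exact (LineSystem.tangent (hx p)).form_comm v w
      nondegenerate := fun p v h => (LineSystem.tangent (hx p)).form_nondegenerate v fun w =>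
        (hg p v w).symm.trans (h w)
      smooth := fun e he => ContDiffOn.congr
        (fun x hx => (L.contDiffAt_metric k (hN e he x hx)).contDiffWithinAt) (hloc e he) }
  exact isSpecialOssermanWith_of_jacobi_eq (L := fun p => LineSystem.tangent (hx p)) hs hk hd hdE
    hg hJ

end Manifold

/-! ### Pairs over the Cayley algebra -/

namespace CayleyAlgebra

variable {s : ℝ}

theorem ip_eq (x y : CayleyAlgebra s) :
    ip x y = x.1.re * y.1.re + x.1.imI * y.1.imI + x.1.imJ * y.1.imJ + x.1.imK * y.1.imK
      - s * (x.2.re * y.2.re + x.2.imI * y.2.imI + x.2.imJ * y.2.imJ + x.2.imK * y.2.imK) := by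
  simp only [ip, re, mul_fst, star_fst, star_snd, star_neg, mul_neg, smul_neg, neg_mul,
    Quaternion.re_add, Quaternion.re_neg, Quaternion.re_smul, Quaternion.re_mul,
    Quaternion.re_star, Quaternion.imI_star, Quaternion.imJ_star, Quaternion.imK_star,
    smul_eq_mul]
  ring

theorem ip_comm (x y : CayleyAlgebra s) : ip x y = ip y x := by
  rw [ip_eq, ip_eq]
  ring

theorem ip_add_left (x y z : CayleyAlgebra s) : ip (x + y) z = ip x z + ip y z := by
  rw [ip, add_mul, re_add, ip, ip]

theorem ip_smul_left (r : ℝ) (x z : CayleyAlgebra s) : ip (r • x) z = r * ip x z := by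
  rw [ip, smul_mul_assoc, re_smul, ip]

theorem ip_add_right (x y z : CayleyAlgebra s) : ip x (y + z) = ip x y + ip x z := by
  rw [ip_comm, ip_add_left, ip_comm y, ip_comm z]

theorem ip_smul_right (r : ℝ) (x z : CayleyAlgebra s) : ip x (r • z) = r * ip x z := by
  rw [ip_comm, ip_smul_left, ip_comm]

theorem normSq_add (x y : CayleyAlgebra s) :
    normSq (x + y) = normSq x + 2 * ip x y + normSq y := by
  simp only [normSq, ip_add_left, ip_add_right, ip_comm y x]
  ring

theorem ip_star_star (x y : CayleyAlgebra s) : ip (star x) (star y) = ip x y := by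
  simp [ip_eq]

theorem ip_mul_left (x y z : CayleyAlgebra s) : ip (x * y) z = ip y (star x * z) := by
  simp only [ip_eq, mul_fst, mul_snd, star_fst, star_snd]
  simp only [Quaternion.re_add, Quaternion.imI_add, Quaternion.imJ_add, Quaternion.imK_add,
    Quaternion.re_neg, Quaternion.imI_neg, Quaternion.imJ_neg, Quaternion.imK_neg,
    Quaternion.re_smul, Quaternion.imI_smul, Quaternion.imJ_smul, Quaternion.imK_smul,
    Quaternion.re_mul, Quaternion.imI_mul, Quaternion.imJ_mul, Quaternion.imK_mul,
    Quaternion.re_star, Quaternion.imI_star, Quaternion.imJ_star, Quaternion.imK_star, smul_eq_mul]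
  ring

theorem ip_mul_right (x y z : CayleyAlgebra s) : ip (x * y) z = ip x (z * star y) := by
  rw [← ip_star_star, star_mul', ip_mul_left, ← ip_star_star, star_mul', star_star', star_star',
    star_star']

theorem eq_zero_of_forall_ip_eq_zero (hs : s ≠ 0) {x : CayleyAlgebra s} (h : ∀ y, ip x y = 0) :
    x = 0 := by
  have h₁ : Quaternion.normSq x.1 = 0 := by
    have h := (ip_eq x (x.1, 0)).symm.trans (h _)
    simp only [Quaternion.re_zero, Quaternion.imI_zero, Quaternion.imJ_zero,
      Quaternion.imK_zero] at h
    rw [Quaternion.normSq_def']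
    linear_combination h
  have h₂ : s * Quaternion.normSq x.2 = 0 := by
    have h := (ip_eq x (0, x.2)).symm.trans (h _)
    simp only [Quaternion.re_zero, Quaternion.imI_zero, Quaternion.imJ_zero,
      Quaternion.imK_zero] at h
    rw [Quaternion.normSq_def']
    linear_combination -h
  exact ext' (Quaternion.normSq_eq_zero.1 h₁)
    (Quaternion.normSq_eq_zero.1 ((mul_eq_zero.1 h₂).resolve_left hs))

theorem star_mul_mul_add (x y z : CayleyAlgebra s) :
    star x * (y * z) + star y * (x * z) = (2 * ip x y) • z := by
  have h := star_mul_mul (x + y) z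
  simp only [star_add', add_mul, mul_add, star_mul_mul, normSq_add] at h
  linear_combination (norm := module) h

theorem mul_star_mul_add (x y z : CayleyAlgebra s) :
    x * (star y * z) + y * (star x * z) = (2 * ip x y) • z := by
  have h := star_mul_mul_add (star x) (star y) z
  rwa [star_star', star_star', ip_star_star] at h

theorem mul_mul_star_add (x y z : CayleyAlgebra s) :
    z * x * star y + z * y * star x = (2 * ip x y) • z := by
  have h := mul_mul_star (x + y) z
  simp only [star_add', add_mul, mul_add, mul_mul_star, normSq_add] at h
  linear_combination (norm := module) h

theorem mul_star_mul (x y : CayleyAlgebra s) : x * (star x * y) = normSq x • y := by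
  have h := star_mul_mul (star x) y
  rwa [star_star', normSq_star] at h

theorem mul_star_mul_cyclic (x y z p q r : CayleyAlgebra s) :
    (x * star q + y * star p) * r + (y * star r + z * star q) * p
        + (z * star p + x * star r) * q =
      (2 : ℝ) • (ip p q • z + ip q r • x + ip r p • y) := by
  have h₁ := mul_mul_star_add (star q) (star r) x
  have h₂ := mul_mul_star_add (star r) (star p) y
  have h₃ := mul_mul_star_add (star p) (star q) z
  simp only [star_star', ip_star_star] at h₁ h₂ h₃
  simp only [add_mul]
  linear_combination (norm := module) h₁ + h₂ + h₃

theorem finrank_eq_eight : Module.finrank ℝ (CayleyAlgebra s) = 8 := by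
  change Module.finrank ℝ (ℍ[ℝ] × ℍ[ℝ]) = 8
  rw [Module.finrank_prod, Quaternion.finrank_eq_four]

section HermOp

/-- The operator with the Hermitian matrix `(α, p; p̄, β)`. -/
def hermOp (α β : ℝ) (p : CayleyAlgebra s) :
    Module.End ℝ (CayleyAlgebra s × CayleyAlgebra s) where
  toFun x := (α • x.1 + p * x.2, β • x.2 + star p * x.1)
  map_add' x y := by
    ext1 <;> simp only [Prod.fst_add, Prod.snd_add, mul_add] <;> module
  map_smul' r x := by
    ext1 <;> simp only [Prod.smul_fst, Prod.smul_snd, mul_smul_comm, RingHom.id_apply] <;> module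

theorem hermOp_apply (α β : ℝ) (p : CayleyAlgebra s) (x : CayleyAlgebra s × CayleyAlgebra s) :
    hermOp α β p x = (α • x.1 + p * x.2, β • x.2 + star p * x.1) := rfl

theorem hermOp_add (α β α' β' : ℝ) (p p' : CayleyAlgebra s) :
    hermOp (α + α') (β + β') (p + p') = hermOp α β p + hermOp α' β' p' := by
  refine LinearMap.ext fun x => Prod.ext ?_ ?_ <;>
    simp only [hermOp_apply, star_add', add_mul, LinearMap.add_apply, Prod.fst_add, Prod.snd_add]
      <;> module

theorem hermOp_smul (r α β : ℝ) (p : CayleyAlgebra s) :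
    hermOp (r * α) (r * β) (r • p) = r • hermOp α β p := by
  refine LinearMap.ext fun x => Prod.ext ?_ ?_ <;>
    simp only [hermOp_apply, star_smul', smul_mul_assoc, LinearMap.smul_apply, Prod.smul_fst,
      Prod.smul_snd] <;> module

theorem hermOp_mul_add_hermOp_mul (α β α' β' : ℝ) (p q : CayleyAlgebra s) :
    hermOp α β p * hermOp α' β' q + hermOp α' β' q * hermOp α β p =
      hermOp (2 * α * α' + 2 * ip p q) (2 * β * β' + 2 * ip p q)
        ((α + β) • q + (α' + β') • p) := by
  refine LinearMap.ext fun x => Prod.ext ?_ ?_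
  · have h := mul_star_mul_add p q x.1
    simp only [LinearMap.add_apply, Module.End.mul_apply, hermOp_apply, Prod.fst_add, mul_add,
      add_mul, mul_smul_comm, smul_mul_assoc]
    linear_combination (norm := module) h
  · have h := star_mul_mul_add p q x.2
    simp only [LinearMap.add_apply, Module.End.mul_apply, hermOp_apply, Prod.snd_add, mul_add,
      add_mul, mul_smul_comm, smul_mul_assoc, star_add', star_smul']
    linear_combination (norm := module) h

theorem trace_hermOp (α β : ℝ) (p : CayleyAlgebra s) :
    LinearMap.trace ℝ _ (hermOp α β p) = 8 * (α + β) := by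
  have hsum : hermOp α β p = LinearMap.prodMap (α • LinearMap.id) (β • LinearMap.id)
      + (LinearMap.inl ℝ _ _ ∘ₗ LinearMap.mulLeft ℝ p ∘ₗ LinearMap.snd ℝ _ _
        + LinearMap.inr ℝ _ _ ∘ₗ LinearMap.mulLeft ℝ (star p) ∘ₗ LinearMap.fst ℝ _ _) := by
    refine LinearMap.ext fun x => Prod.ext ?_ ?_ <;> simp [hermOp_apply]
  have hinl : LinearMap.trace ℝ _ (LinearMap.inl ℝ (CayleyAlgebra s) (CayleyAlgebra s) ∘ₗ
      LinearMap.mulLeft ℝ p ∘ₗ LinearMap.snd ℝ _ _) = 0 := by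
    rw [LinearMap.trace_comp_comm', LinearMap.comp_assoc, LinearMap.snd_comp_inl,
      LinearMap.comp_zero, map_zero]
  have hinr : LinearMap.trace ℝ _ (LinearMap.inr ℝ (CayleyAlgebra s) (CayleyAlgebra s) ∘ₗ
      LinearMap.mulLeft ℝ (star p) ∘ₗ LinearMap.fst ℝ _ _) = 0 := by
    rw [LinearMap.trace_comp_comm', LinearMap.comp_assoc, LinearMap.fst_comp_inr,
      LinearMap.comp_zero, map_zero]
  rw [hsum, map_add, map_add, hinl, hinr, LinearMap.trace_prodMap', map_smul, map_smul,
    LinearMap.trace_id, finrank_eq_eight, smul_eq_mul, smul_eq_mul]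
  push_cast
  ring

end HermOp

section PairSystem

variable (a b c x y : CayleyAlgebra s × CayleyAlgebra s)

/-- The bilinear form `⟨a₁, b₁⟩ + ⟨a₂, b₂⟩` on pairs. -/
def pairForm : (CayleyAlgebra s × CayleyAlgebra s) →ₗ[ℝ]
    (CayleyAlgebra s × CayleyAlgebra s) →ₗ[ℝ] ℝ :=
  LinearMap.mk₂ ℝ (fun a b => ip a.1 b.1 + ip a.2 b.2)
    (fun a b c => by simp only [Prod.fst_add, Prod.snd_add, ip_add_left]; ring)
    (fun r a b => by simp only [Prod.smul_fst, Prod.smul_snd, ip_smul_left, smul_eq_mul]; ring)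
    (fun a b c => by simp only [Prod.fst_add, Prod.snd_add, ip_add_right]; ring)
    (fun r a b => by simp only [Prod.smul_fst, Prod.smul_snd, ip_smul_right, smul_eq_mul]; ring)

theorem pairForm_apply : pairForm a b = ip a.1 b.1 + ip a.2 b.2 := rfl

theorem pairForm_comm : pairForm a b = pairForm b a := by
  rw [pairForm_apply, pairForm_apply, ip_comm, ip_comm a.2]

theorem pairForm_nondegenerate (hs : s ≠ 0) (h : ∀ b, pairForm a b = 0) : a = 0 :=
  Prod.ext
    (eq_zero_of_forall_ip_eq_zero hs fun y => by simpa [pairForm_apply, ip_eq a.2] using h (y, 0))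
    (eq_zero_of_forall_ip_eq_zero hs fun y => by simpa [pairForm_apply, ip_eq a.1] using h (0, y))

/-- The polarization of `2 a a*`, the column `a` times its conjugate row: a Hermitian matrix over
the Cayley algebra, acting on columns. -/
def pairOp : (CayleyAlgebra s × CayleyAlgebra s) →ₗ[ℝ] (CayleyAlgebra s × CayleyAlgebra s) →ₗ[ℝ]
    Module.End ℝ (CayleyAlgebra s × CayleyAlgebra s) :=
  LinearMap.mk₂ ℝ (fun a b => hermOp (2 * ip a.1 b.1) (2 * ip a.2 b.2)
      (a.1 * star b.2 + b.1 * star a.2))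
    (fun a b c => by
      rw [← hermOp_add]
      congr 1
      · simp only [Prod.fst_add, ip_add_left]; ring
      · simp only [Prod.snd_add, ip_add_left]; ring
      · simp only [Prod.fst_add, Prod.snd_add, star_add', add_mul, mul_add]; abel)
    (fun r a b => by
      rw [← hermOp_smul]
      congr 1
      · simp only [Prod.smul_fst, ip_smul_left]; ring
      · simp only [Prod.smul_snd, ip_smul_left]; ring
      · simp only [Prod.smul_fst, Prod.smul_snd, star_smul', smul_mul_assoc, mul_smul_comm,
          smul_add])
    (fun a b c => by
      rw [← hermOp_add]
      congr 1
      · simp only [Prod.fst_add, ip_add_right]; ring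
      · simp only [Prod.snd_add, ip_add_right]; ring
      · simp only [Prod.fst_add, Prod.snd_add, star_add', add_mul, mul_add]; abel)
    (fun r a b => by
      rw [← hermOp_smul]
      congr 1
      · simp only [Prod.smul_fst, ip_smul_right]; ring
      · simp only [Prod.smul_snd, ip_smul_right]; ring
      · simp only [Prod.smul_fst, Prod.smul_snd, star_smul', smul_mul_assoc, mul_smul_comm,
          smul_add])

theorem pairOp_eq : pairOp a b =
    hermOp (2 * ip a.1 b.1) (2 * ip a.2 b.2) (a.1 * star b.2 + b.1 * star a.2) := rfl

theorem pairOp_apply_fst : (pairOp a b x).1 =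
    (2 * ip a.1 b.1) • x.1 + (a.1 * star b.2 + b.1 * star a.2) * x.2 := rfl

theorem pairOp_apply_snd : (pairOp a b x).2 =
    (2 * ip a.2 b.2) • x.2 + (a.2 * star b.1 + b.2 * star a.1) * x.1 := by
  rw [pairOp_eq, hermOp_apply, star_add', star_mul', star_mul', star_star', star_star',
    add_comm (b.2 * _)]

theorem pairOp_comm : pairOp a b = pairOp b a := by
  rw [pairOp_eq, pairOp_eq, ip_comm, ip_comm a.2, add_comm]

theorem pairForm_pairOp_swap : pairForm (pairOp a b x) y = pairForm (pairOp x y a) b := by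
  have h (p q r t : CayleyAlgebra s) : ip (p * star q * r) t = ip (t * star r * q) p := by
    rw [ip_mul_right, ip_mul_right, ip_comm, star_star']
  have h' (p q r t : CayleyAlgebra s) : ip (p * star q * r) t = ip (r * star t * p) q := by
    rw [h, ip_mul_right (t * star r), ← ip_star_star, star_mul', star_star', star_mul',
      star_star', ← ip_mul_right]
  simp only [pairForm_apply, pairOp_apply_fst, pairOp_apply_snd, add_mul, ip_add_left,
    ip_smul_left]
  rw [h' a.1 b.2 x.2 y.1, h b.1 a.2 x.2 y.1, h' a.2 b.1 x.1 y.2, h b.2 a.1 x.1 y.2]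
  ring

theorem pairOp_cyclic : pairOp a b c + pairOp b c a + pairOp c a b =
    (2 : ℝ) • (pairForm a b • c + pairForm b c • a + pairForm c a • b) := by
  refine Prod.ext ?_ ?_ <;>
    simp only [Prod.fst_add, Prod.snd_add, Prod.smul_fst, Prod.smul_snd, pairForm_apply,
      pairOp_apply_fst, pairOp_apply_snd]
  · linear_combination (norm := module) mul_star_mul_cyclic a.1 b.1 c.1 a.2 b.2 c.2
  · linear_combination (norm := module) mul_star_mul_cyclic a.2 b.2 c.2 a.1 b.1 c.1

theorem two_smul_pairOp_hermOp (α β : ℝ) (p : CayleyAlgebra s) :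
    (2 : ℝ) • pairOp a (hermOp α β p a) =
      hermOp α β p * pairOp a a + pairOp a a * hermOp α β p := by
  have hip₁ : ip a.1 (p * a.2) = ip p (a.1 * star a.2) := by rw [ip_comm, ip_mul_right]
  have hip₂ : ip a.2 (star p * a.1) = ip p (a.1 * star a.2) := by
    rw [← ip_mul_left, ip_mul_right]
  rw [pairOp_eq, pairOp_eq, hermOp_mul_add_hermOp_mul, ← hermOp_smul]
  simp only [hermOp_apply, ip_add_right, ip_smul_right, star_add', star_smul', star_mul',
    star_star', mul_add, add_mul, mul_smul_comm, smul_mul_assoc, mul_star_mul, mul_mul_star,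
    hip₁, hip₂]
  congr 1
  · ring
  · ring
  · simp only [normSq]
    module

/-- The line system on pairs of octonions (up to rescaling, `s < 0`) or para-octonions
(`0 < s`). Its line through `(1, m)` consists of the pairs `(c, m * c)`. -/
def pairSystem (hs : s ≠ 0) : LineSystem (CayleyAlgebra s × CayleyAlgebra s) 8 where
  form := pairForm
  op := pairOp
  form_comm := pairForm_comm
  form_nondegenerate a := pairForm_nondegenerate a hs
  op_comm := pairOp_comm
  form_op_swap := pairForm_pairOp_swap
  op_cyclic := pairOp_cyclic
  two_smul_op_op v x := two_smul_pairOp_hermOp v _ _ _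
  trace_op a b := by
    rw [pairOp_eq, trace_hermOp, pairForm_apply]
    push_cast
    ring

end PairSystem

end CayleyAlgebra

/-! ### Charts and transition maps -/

section LocalMetric

variable {E : Type*} [NormedAddCommGroup E] [NormedSpace ℝ E] {G : E → E →L[ℝ] E →L[ℝ] ℝ}
  {f h : E → E} {x : E}

/-- The derivative of `f` at `x` is an isometry for the metric with local expression `G`. -/
structure PreservesMetricAt (G : E → E →L[ℝ] E →L[ℝ] ℝ) (f : E → E) (x : E) : Prop where
  differentiableAt : DifferentiableAt ℝ f x
  apply_fderiv : ∀ a b, G (f x) (fderiv ℝ f x a) (fderiv ℝ f x b) = G x a b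

namespace PreservesMetricAt

theorem of_apply_self (hG : ∀ y a b, G y a b = G y b a) (hf : DifferentiableAt ℝ f x)
    (h : ∀ a, G (f x) (fderiv ℝ f x a) (fderiv ℝ f x a) = G x a a) :
    PreservesMetricAt G f x := by
  refine ⟨hf, fun a b => ?_⟩
  have hab := h (a + b)
  simp only [map_add, add_apply, h, hG x b a, hG (f x) (fderiv ℝ f x b)] at hab
  linarith

theorem id : PreservesMetricAt G id x :=
  ⟨differentiableAt_id, fun a b => by rw [fderiv_id]; rfl⟩

theorem comp (hh : PreservesMetricAt G h (f x)) (hf : PreservesMetricAt G f x) :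
    PreservesMetricAt G (h ∘ f) x := by
  refine ⟨hh.differentiableAt.comp x hf.differentiableAt, fun a b => ?_⟩
  rw [fderiv_comp x hh.differentiableAt hf.differentiableAt]
  exact (hh.apply_fderiv _ _).trans (hf.apply_fderiv a b)

end PreservesMetricAt

theorem localMetric_eq_of_preservesMetricAt {M : Type*} [TopologicalSpace M] [ChartedSpace E M]
    [IsManifold 𝓘(ℝ, E) 1 M]
    {g : ∀ p : M, TangentSpace 𝓘(ℝ, E) p →L[ℝ] TangentSpace 𝓘(ℝ, E) p →L[ℝ] ℝ}
    (hg : ∀ p, g p = G (chartAt E p p)) {e : OpenPartialHomeomorph M E} (he : e ∈ atlas E M)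
    (hx : x ∈ e.target) (hf : (fun y => chartAt E (e.symm x) (e.symm y)) =ᶠ[nhds x] f)
    (h : PreservesMetricAt G f x) : localMetric g e x = G x := by
  have hfderiv : (mfderiv 𝓘(ℝ, E) 𝓘(ℝ, E) e.symm x : E →L[ℝ] E) = fderiv ℝ f x := by
    rw [← hf.fderiv_eq]
    refine (mdifferentiableAt_atlas_symm he hx).mfderiv.trans ?_
    rw [modelWithCornersSelf_coe, Set.range_id, fderivWithin_univ]
    rfl
  have hgx : g (e.symm x) = G (f x) := by rw [hg, ← hf.eq_of_nhds]
  refine ContinuousLinearMap.ext fun a => ContinuousLinearMap.ext fun b => ?_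
  rw [← h.apply_fderiv, ← hfderiv, ← hgx]
  rfl

end LocalMetric

namespace CayleyAlgebra

variable {s : ℝ}

section FubiniStudy

theorem re_mul (x y : CayleyAlgebra s) : re (x * y) = ip x (star y) := by
  rw [ip, star_star']

theorem denom_pairSystem (hs : s ≠ 0) (k : ℝ) (x : CayleyAlgebra s × CayleyAlgebra s) :
    (pairSystem hs).denom k x = 1 + k * normSq x.1 + k * normSq x.2 := by
  change 1 + k * (normSq x.1 + normSq x.2) = _
  ring

theorem pairForm_pairOp_self (x a b : CayleyAlgebra s × CayleyAlgebra s) :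
    pairForm (pairOp x x a) b = 2 * (normSq x.1 * ip a.1 b.1 + normSq x.2 * ip a.2 b.2
      + re (x.1 * star x.2 * (a.2 * star b.1)) + re (x.1 * star x.2 * (b.2 * star a.1))) := by
  have h₁ : re (x.1 * star x.2 * (a.2 * star b.1)) = ip (x.1 * star x.2 * a.2) b.1 := by
    rw [re_mul, star_mul', star_star', ← ip_mul_right]
  have h₂ : re (x.1 * star x.2 * (b.2 * star a.1)) = ip (x.2 * star x.1 * a.1) b.2 := by
    rw [re_mul, ← ip_star_star, star_star', star_mul', star_star', ← ip_mul_right]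
  rw [pairForm_apply, pairOp_apply_fst, pairOp_apply_snd, h₁, h₂]
  simp only [normSq, ip_add_left, ip_smul_left, add_mul]
  ring

theorem fubiniStudyForm_eq_metric (hs : s ≠ 0) (k : ℝ) :
    fubiniStudyForm (s := s) k = (pairSystem hs).metric k := by
  refine funext fun x => ContinuousLinearMap.ext fun a => ContinuousLinearMap.ext fun b => ?_
  have hmetric : (pairSystem hs).metric k x a b =
      ((pairSystem hs).denom k x)⁻¹ * pairForm a b
        - k / 2 * ((pairSystem hs).denom k x)⁻¹ ^ 2 * pairForm (pairOp x x a) b := by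
    rw [LineSystem.metric_eq_smul_sub]
    rfl
  have hinv : ((pairSystem hs).denom k x)⁻¹ =
      (1 + k * normSq x.1 + k * normSq x.2) * ((pairSystem hs).denom k x)⁻¹ ^ 2 := by
    rw [← denom_pairSystem hs]
    rcases eq_or_ne ((pairSystem hs).denom k x) 0 with h | h
    · simp [h]
    · field_simp
  rw [hmetric, fubiniStudyForm_apply, ← denom_pairSystem hs, pairForm_pairOp_self, pairForm_apply]
  linear_combination -(ip a.1 b.1 + ip a.2 b.2) * hinv

theorem fubiniStudyForm_comm (k : ℝ) (x a b : CayleyAlgebra s × CayleyAlgebra s) :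
    fubiniStudyForm k x a b = fubiniStudyForm k x b a := by
  simp only [fubiniStudyForm_apply, ip_comm b.1, ip_comm b.2]
  ring

end FubiniStudy

section Transition

/-- The transition map `(u, v) ↦ (u⁻¹, v u⁻¹)` between the charts `[1, u, v]` and `[u, 1, v]`. -/
def invMap (x : CayleyAlgebra s × CayleyAlgebra s) : CayleyAlgebra s × CayleyAlgebra s :=
  (x.1⁻¹, x.2 * x.1⁻¹)

/-- The derivative of `u ↦ u⁻¹` in the direction `a`. In an associative algebra it would be
`-u⁻¹ a u⁻¹`; this is the derivative of the formula `ū / |u|²` for the inverse. -/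
def invDeriv (u a : CayleyAlgebra s) : CayleyAlgebra s :=
  (normSq u)⁻¹ • star a - (2 * ip u a / normSq u ^ 2) • star u

variable {u : CayleyAlgebra s} {x : CayleyAlgebra s × CayleyAlgebra s}

theorem hasLineDerivAt_inv (hu : normSq u ≠ 0) (a : CayleyAlgebra s) :
    HasLineDerivAt ℝ (fun y => y⁻¹) (invDeriv u a) u a := by
  have hinv : (fun t : ℝ => (u + t • a)⁻¹) = fun t : ℝ =>
      (normSq u + t * (2 * ip u a) + t ^ 2 * normSq a)⁻¹ • (star u + t • star a) := by
    ext1 t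
    rw [inv_def, normSq_add, ip_smul_right, normSq_smul, star_add', star_smul']
    congr 2
    ring
  rw [HasLineDerivAt, hinv]
  have hnormSq := (((hasDerivAt_id (0 : ℝ)).mul_const (2 * ip u a)).const_add (normSq u)).fun_add
    (((hasDerivAt_id (0 : ℝ)).fun_pow 2).mul_const (normSq a))
  have hstar := ((hasDerivAt_id (0 : ℝ)).smul_const (star a)).const_add (star u)
  refine ((hnormSq.fun_inv (by simpa using hu)).fun_smul hstar).congr_deriv ?_
  simp only [id, invDeriv]
  module

theorem hasDerivAt_mul {f g : ℝ → CayleyAlgebra s} {f' g' : CayleyAlgebra s} {t : ℝ}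
    (hf : HasDerivAt f f' t) (hg : HasDerivAt g g' t) :
    HasDerivAt (fun r => f r * g r) (f t * g' + f' * g t) t :=
  ((LinearMap.mul ℝ (CayleyAlgebra s)).toContinuousBilinearMap.isBoundedBilinearMap.hasFDerivAt
    (f t, g t)).comp_hasDerivAt t (hf.prodMk hg)

theorem differentiableAt_invMap (hx : normSq x.1 ≠ 0) : DifferentiableAt ℝ invMap x := by
  have hfst : ContDiffAt ℝ ∞ (fun y : CayleyAlgebra s × CayleyAlgebra s => y.1⁻¹) x :=
    ((contDiff_normSq.comp contDiff_fst).contDiffAt.inv hx).smul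
      (contDiff_star.comp contDiff_fst).contDiffAt
  have h : ContDiffAt ℝ ∞ (invMap (s := s)) x :=
    hfst.prodMk (contDiff_mul.contDiffAt.comp x (contDiff_snd.contDiffAt.prodMk hfst))
  exact h.differentiableAt (by simp)

theorem fderiv_invMap (hx : normSq x.1 ≠ 0) (a : CayleyAlgebra s × CayleyAlgebra s) :
    fderiv ℝ invMap x a = (invDeriv x.1 a.1, a.2 * x.1⁻¹ + x.2 * invDeriv x.1 a.1) := by
  rw [← (differentiableAt_invMap hx).lineDeriv_eq_fderiv]
  refine HasLineDerivAt.lineDeriv ?_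
  have hfst : HasDerivAt (fun t : ℝ => (x.1 + t • a.1)⁻¹) (invDeriv x.1 a.1) 0 :=
    hasLineDerivAt_inv hx a.1
  have hsnd : HasDerivAt (fun t : ℝ => x.2 + t • a.2) a.2 0 := by
    simpa using ((hasDerivAt_id (0 : ℝ)).smul_const a.2).const_add x.2
  refine (hfst.prodMk (hasDerivAt_mul hsnd hfst)).congr_deriv ?_
  rw [zero_smul, zero_smul, add_zero, add_zero, add_comm (x.2 * _)]

theorem normSq_invDeriv (hu : normSq u ≠ 0) (a : CayleyAlgebra s) :
    normSq (invDeriv u a) = normSq a / normSq u ^ 2 := by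
  rw [invDeriv, sub_eq_add_neg, ← neg_smul, normSq_add, normSq_smul, normSq_smul, ip_smul_left,
    ip_smul_right, ip_star_star, normSq_star, normSq_star, ip_comm a u]
  field_simp
  ring

theorem mul_invDeriv_mul (hu : normSq u ≠ 0) (v a : CayleyAlgebra s) :
    v * invDeriv u a * u = -(normSq u)⁻¹ • (v * star u * a) := by
  have h := mul_mul_star_add (star u) (star a) v
  have hself := mul_mul_star (star u) v
  rw [star_star', star_star', ip_star_star] at h
  rw [star_star', normSq_star] at hself
  have hcoeff : 2 * ip u a / normSq u ^ 2 * normSq u = (normSq u)⁻¹ * (2 * ip u a) := by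
    field_simp
  rw [invDeriv, mul_sub, sub_mul, mul_smul_comm, mul_smul_comm, smul_mul_assoc, smul_mul_assoc,
    hself, smul_smul, hcoeff]
  linear_combination (norm := module) (normSq u)⁻¹ • h

theorem ip_invDeriv (hu : normSq u ≠ 0) (v a b : CayleyAlgebra s) :
    ip (b * u⁻¹) (v * invDeriv u a) = -re (u * star v * (b * star a)) / normSq u ^ 2 := by
  have hre : re (u * star v * (b * star a)) = ip b (v * star u * a) := by
    rw [re_mul, ← ip_star_star]
    simp only [star_mul', star_star']
    rw [← ip_mul_right, ip_comm]
  rw [inv_def, mul_smul_comm, ip_smul_left, ip_mul_right, star_star', mul_invDeriv_mul hu,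
    ip_smul_right, hre]
  field_simp

theorem preservesMetricAt_invMap (hx : 0 < normSq x.1) :
    PreservesMetricAt (fubiniStudyForm 1) invMap x := by
  refine .of_apply_self (fubiniStudyForm_comm 1) (differentiableAt_invMap hx.ne') fun a => ?_
  rw [fderiv_invMap hx.ne']
  obtain ⟨u, v⟩ := x
  obtain ⟨a, b⟩ := a
  simp only [invMap] at hx ⊢
  have hu : normSq u ≠ 0 := hx.ne'
  have hcoords : u⁻¹ * star (v * u⁻¹) = (normSq u)⁻¹ • star v := by
    rw [star_mul', mul_star_mul, normSq_inv]
  have hcross :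
      re (u⁻¹ * star (v * u⁻¹) * ((b * u⁻¹ + v * invDeriv u a) * star (invDeriv u a))) =
        (normSq u)⁻¹ * (ip (b * u⁻¹) (v * invDeriv u a) + normSq v * normSq (invDeriv u a)) := by
    rw [hcoords, smul_mul_assoc, re_smul, re_mul, ip_star_star, ← ip_mul_right, ip_comm,
      ip_add_left, ← normSq_mul]
    rfl
  have hdenom : 1 + (normSq u)⁻¹ + normSq v * (normSq u)⁻¹ =
      (1 + normSq u + normSq v) / normSq u := by
    field_simp
    ring
  rw [fubiniStudyForm_self, fubiniStudyForm_self, hcross, normSq_add, normSq_mul, normSq_mul,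
    normSq_mul, normSq_inv, ip_invDeriv hu, normSq_invDeriv hu, hdenom, div_pow,
    div_div_eq_mul_div]
  congr 1
  field_simp
  ring

theorem preservesMetricAt_swap : PreservesMetricAt (fubiniStudyForm 1) Prod.swap x := by
  have hswap : (Prod.swap : CayleyAlgebra s × CayleyAlgebra s → _) =
    (ContinuousLinearEquiv.prodComm ℝ (CayleyAlgebra s) (CayleyAlgebra s)) := rfl
  rw [hswap]
  refine .of_apply_self (fubiniStudyForm_comm 1) (ContinuousLinearEquiv.differentiableAt _)
    fun a => ?_
  rw [ContinuousLinearEquiv.fderiv]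
  obtain ⟨u, v⟩ := x
  obtain ⟨b, c⟩ := a
  change fubiniStudyForm 1 (v, u) (c, b) (c, b) = _
  have hre : re (v * star u * (b * star c)) = re (u * star v * (c * star b)) := by
    rw [re_mul, re_mul, ← ip_star_star]
    simp only [star_mul', star_star']
  rw [fubiniStudyForm_self, fubiniStudyForm_self, hre]
  ring

theorem transition_self (i : Fin 3) : transition (s := s) i i = id := by
  ext1 y
  simp only [transition, triple_self, inv_one', mul_one]
  exact affinePart_triple i y

theorem preservesMetricAt_transition (i j : Fin 3) (h : 0 < normSq (triple i x j)) :
    PreservesMetricAt (fubiniStudyForm 1) (transition i j) x := by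
  have hinv : 0 < normSq x.1 → PreservesMetricAt (fubiniStudyForm 1) invMap x :=
    preservesMetricAt_invMap
  have hinvSwap (h : 0 < normSq x.2) :
      PreservesMetricAt (fubiniStudyForm 1) (invMap ∘ Prod.swap) x :=
    (preservesMetricAt_invMap (x := x.swap) h).comp preservesMetricAt_swap
  have h₀₁ : transition (s := s) 0 1 = invMap := funext fun y => Prod.ext (one_mul _) rfl
  have h₀₂ : transition (s := s) 0 2 = invMap ∘ Prod.swap :=
    funext fun y => Prod.ext (one_mul _) rfl
  have h₁₀ : transition (s := s) 1 0 = invMap := funext fun y => Prod.ext (one_mul _) rfl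
  have h₁₂ : transition (s := s) 1 2 = Prod.swap ∘ invMap ∘ Prod.swap :=
    funext fun y => Prod.ext rfl (one_mul _)
  have h₂₀ : transition (s := s) 2 0 = Prod.swap ∘ invMap :=
    funext fun y => Prod.ext rfl (one_mul _)
  have h₂₁ : transition (s := s) 2 1 = Prod.swap ∘ invMap ∘ Prod.swap :=
    funext fun y => Prod.ext rfl (one_mul _)
  fin_cases i <;> fin_cases j
  · exact transition_self (s := s) 0 ▸ .id
  · exact h₀₁ ▸ hinv h
  · exact h₀₂ ▸ hinvSwap h
  · exact h₁₀ ▸ hinv h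
  · exact transition_self (s := s) 1 ▸ .id
  · exact h₁₂ ▸ preservesMetricAt_swap.comp (hinvSwap h)
  · exact h₂₀ ▸ preservesMetricAt_swap.comp (hinv h)
  · exact h₂₁ ▸ preservesMetricAt_swap.comp (hinvSwap h)
  · exact transition_self (s := s) 2 ▸ .id

end Transition

end CayleyAlgebra

theorem localMetric_planeMetric {s : ℝ} (i : Fin 3) {x : CayleyAlgebra s × CayleyAlgebra s}
    (hx : x ∈ coordDomain s) :
    localMetric (planeMetric s) (planeHomeo s i) x = fubiniStudyForm 1 x := by
  set p : Plane s := (planeHomeo s i).symm x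
  obtain ⟨j, hj⟩ := (mem_atlas_plane_iff _).1
    (chart_mem_atlas (CayleyAlgebra s × CayleyAlgebra s) p)
  have hmem : x ∈ coordDomain s ∩ {x | 0 < normSq (triple i x j)} := by
    rw [← planeChart_trans_source]
    have hp := mem_chart_source (CayleyAlgebra s × CayleyAlgebra s) p
    rw [hj] at hp
    exact ⟨hx, hp⟩
  have htransition : (fun y => chartAt (CayleyAlgebra s × CayleyAlgebra s) p
      ((planeHomeo s i).symm y)) =ᶠ[nhds x] transition i j := by
    rw [hj]
    exact (planeChart_trans_eqOn s i j).eventuallyEq_of_mem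
      ((isOpen_transition_source s i j).mem_nhds hmem)
  exact localMetric_eq_of_preservesMetricAt (fun _ => rfl) ((mem_atlas_plane_iff _).2 ⟨i, rfl⟩) hx
    htransition (preservesMetricAt_transition i j hmem.2)

theorem localMetric_hyperbolicMetric
    {e : OpenPartialHomeomorph HyperbolicPlane (Octonion × Octonion)}
    (he : e ∈ atlas (Octonion × Octonion) HyperbolicPlane) {x : Octonion × Octonion}
    (hx : x ∈ e.target) :
    x ∈ HyperbolicPlane ∧ localMetric hyperbolicMetric e x = fubiniStudyForm (-1) x := by
  have hcoe : ∀ p : HyperbolicPlane, e p = p.1 := by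
    obtain ⟨q, hq⟩ := Set.mem_iUnion.1 he
    rw [Set.mem_singleton_iff.1 hq]
    exact fun p => rfl
  have hsymm : ∀ y ∈ e.target, (e.symm y).1 = y := fun y hy => by
    rw [← hcoe, e.right_inv hy]
  exact ⟨hsymm x hx ▸ (e.symm x).2, localMetric_eq_of_preservesMetricAt (fun _ => rfl) he hx
    (Filter.mem_of_superset (e.open_target.mem_nhds hx) hsymm) .id⟩

theorem finrank_cayleyAlgebra_prod (s : ℝ) :
    Module.finrank ℝ (CayleyAlgebra s × CayleyAlgebra s) = 16 := by
  rw [Module.finrank_prod, finrank_eq_eight]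

theorem isSpecialOssermanWith_of_localMetric_eq_fubiniStudyForm {s k : ℝ} (hs : s ≠ 0)
    (hk : k ≠ 0) {M : Type*} [TopologicalSpace M]
    [ChartedSpace (CayleyAlgebra s × CayleyAlgebra s) M]
    {g : ∀ p : M, TangentSpace 𝓘(ℝ, CayleyAlgebra s × CayleyAlgebra s) p →L[ℝ]
      TangentSpace 𝓘(ℝ, CayleyAlgebra s × CayleyAlgebra s) p →L[ℝ] ℝ}
    (hg : ∀ p, g p = fubiniStudyForm k (chartAt (CayleyAlgebra s × CayleyAlgebra s) p p))
    (hloc : ∀ e ∈ atlas (CayleyAlgebra s × CayleyAlgebra s) M,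
      Set.EqOn (localMetric g e) (fubiniStudyForm k) e.target)
    (hN : ∀ e ∈ atlas (CayleyAlgebra s × CayleyAlgebra s) M, ∀ x ∈ e.target,
      1 + k * normSq x.1 + k * normSq x.2 ≠ 0) :
    IsSpecialOssermanWith g (4 * k) k ∧ HasMultiplicity g (4 * k) 7 ∧ HasMultiplicity g k 8 := by
  rw [fubiniStudyForm_eq_metric hs] at hg hloc
  have h := isSpecialOssermanWith_of_localMetric_eq (pairSystem hs) hk (by norm_num)
    (by rw [finrank_cayleyAlgebra_prod]; norm_num) (fun p v w => by rw [hg]; rfl) hloc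
    (fun e he x hx => denom_pairSystem hs k x ▸ hN e he x hx)
  rwa [finrank_cayleyAlgebra_prod] at h

theorem plane_isSpecialOssermanWith {s : ℝ} (hs : s ≠ 0) :
    IsSpecialOssermanWith (M := Plane s) (planeMetric s) 4 1 ∧
      HasMultiplicity (M := Plane s) (planeMetric s) 4 7 ∧
      HasMultiplicity (M := Plane s) (planeMetric s) 1 8 := by
  have h := isSpecialOssermanWith_of_localMetric_eq_fubiniStudyForm (M := Plane s)
    (g := planeMetric s) hs one_ne_zero (fun _ => rfl)
    (fun e he x hx => by
      obtain ⟨i, rfl⟩ := (mem_atlas_plane_iff e).1 he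
      exact localMetric_planeMetric i hx)
    (fun e he x hx => by
      obtain ⟨i, rfl⟩ := (mem_atlas_plane_iff e).1 he
      have hx' : 0 < 1 + normSq x.1 + normSq x.2 := hx
      rw [one_mul, one_mul]
      exact hx'.ne')
  rwa [mul_one] at h

theorem hyperbolicPlane_isSpecialOssermanWith :
    IsSpecialOssermanWith (M := HyperbolicPlane) hyperbolicMetric (-4) (-1) ∧
      HasMultiplicity (M := HyperbolicPlane) hyperbolicMetric (-4) 7 ∧
      HasMultiplicity (M := HyperbolicPlane) hyperbolicMetric (-1) 8 := by
  have hneg : (-1 : ℝ) ≠ 0 := by norm_num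
  have h := isSpecialOssermanWith_of_localMetric_eq_fubiniStudyForm (M := HyperbolicPlane)
    (g := hyperbolicMetric) hneg hneg (fun _ => rfl)
    (fun e he x hx => (localMetric_hyperbolicMetric he hx).2)
    (fun e he x hx => by
      have hx' : normSq x.1 + normSq x.2 < 1 := (localMetric_hyperbolicMetric he hx).1
      linarith)
  rwa [mul_neg_one] at h

end

theorem mainTheorem3 :
    -- the octonionic projective plane
    ((∀ i, ∀ x ∈ coordDomain (-1),
        localMetric (planeMetric (-1)) (planeHomeo (-1) i) x = fubiniStudyForm 1 x) ∧
      IsSpecialOssermanWith (M := OctonionicPlane) (planeMetric (-1)) 4 1 ∧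
      HasMultiplicity (M := OctonionicPlane) (planeMetric (-1)) 4 7 ∧
      HasMultiplicity (M := OctonionicPlane) (planeMetric (-1)) 1 8) ∧
    -- the para-octonionic projective plane
    ((∀ i, ∀ x ∈ coordDomain 1,
        localMetric (planeMetric 1) (planeHomeo 1 i) x = fubiniStudyForm 1 x) ∧
      IsSpecialOssermanWith (M := ParaOctonionicPlane) (planeMetric 1) 4 1 ∧
      HasMultiplicity (M := ParaOctonionicPlane) (planeMetric 1) 4 7 ∧
      HasMultiplicity (M := ParaOctonionicPlane) (planeMetric 1) 1 8) ∧
    -- the octonionic hyperbolic plane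
    (IsSpecialOssermanWith (M := HyperbolicPlane) hyperbolicMetric (-4) (-1) ∧
      HasMultiplicity (M := HyperbolicPlane) hyperbolicMetric (-4) 7 ∧
      HasMultiplicity (M := HyperbolicPlane) hyperbolicMetric (-1) 8) := by
  have hneg : (-1 : ℝ) ≠ 0 := by norm_num
  exact ⟨⟨fun i _ hx => localMetric_planeMetric i hx, plane_isSpecialOssermanWith hneg⟩,
    ⟨fun i _ hx => localMetric_planeMetric i hx, plane_isSpecialOssermanWith one_ne_zero⟩,
    hyperbolicPlane_isSpecialOssermanWith⟩
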